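/- Setting. Let $\mathbb F$ be $\mathbb R$ or $\mathbb C$. Let $\Gamma$ be a $*$-semigroupoid (not necessarily with unit) with set of symbols $S$, domain and codomain maps $d,c\colon\Gamma\to S$, partially defined associative product $\alpha\beta$ (for $d(\alpha)=c(\beta)$) and involution $\alpha\mapsto\alpha^*$ with $d(\alpha^*)=c(\alpha)$, $c(\alpha^*)=d(\alpha)$, $(\alpha\beta)^*=\beta^*\alpha^*$, $\alpha^{**}=\alpha$. Let $\Gamma$ act from the left on a set $X$ with surjective anchor map $a\colon X\to S$: $\alpha\cdot x\in X$ is defined when $d(\alpha)=a(x)$, $a(\alpha\cdot x)=c(\alpha)$ and $(\alpha\beta)\cdot x=\alpha\cdot(\beta\cdot x)$. Put $X_s=a^{-1}(\{s\})$. Let $\boldsymbol H=\{\mathcal H_x\}_{x\in X}$ be a bundle of Hilbert spaces over $\mathbb F$ that is constant along orbits, $\mathcal H_{\alpha\cdot x}=\mathcal H_x$, and put $\boldsymbol H_s=\{\mathcal H_x\}_{x\in X_s}$. A kernel is a family of bounded operators $K(x,y)\colon\mathcal H_y\to\mathcal H_x$, $x,y\in X$; $K^s$ is its restriction to $X_s\times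 X_s$, and for finitely supported sections $f,g\in\mathcal F^0(X_s;\boldsymbol H_s)$ let $[f,g]_K=\sum_{x,y}\langle K(y,x)f(x),g(y)\rangle$. (Inner products are linear in the first variable.) A kernel $K$ is partially Hermitian if $K(x,y)^*=K(y,x)$ whenever $a(x)=a(y)$; partially positive semidefinite if, in addition, $[f,f]_K\ge 0$ for all $s\in S$, $f\in\mathcal F^0(X_s;\boldsymbol H_s)$; $K\le L$ means that $L-K$ is partially positive semidefinite. $K$ is $\Gamma$-invariant if $K(\alpha\cdot x,y)=K(x,\alpha^*\cdot y)$ whenever $d(\alpha)=a(x)$, $c(\alpha)=a(y)$. A partially positive semidefinite $L$ is of bounded shift type if for every $\alpha\in\Gamma$ there is $M_\alpha\ge0$ such that $\sum_{x,y}\langle L(\alpha\cdot x,\alpha\cdot y)g_y,g_x\rangle\le M_\alpha\sum_{x,y}\langle L(x,y)g_y,g_x\rangle$ for all $g\in\mathcal F^0(X_{d(\alpha)};\boldsymbol H_{d(\alpha)})$. Partially positive semidefinite kernels $L_1,L_2$ are disjoint if every partially positive semidefinite $L$ with $L\le L_1$ and $L\le L_2$ has $L^s=0$ for all $s\in S$.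 A fundamental symmetry of an inner product space $(\mathcal K,[\cdot,\cdot])$ is a linear $J\colon\mathcal K\to\mathcal K$ with $J^2=I$ such that $\langle x,y\rangle_J=[Jx,y]$ is a positive definite inner product making $\mathcal K$ a Hilbert space; a Krein space is an inner product space that has a fundamental symmetry, with the (unique) norm topology so obtained. $T^\sharp$ denotes the Krein space adjoint. A bounded $*$-representation of $\Gamma$ on a bundle $\{\mathcal K_s\}_{s\in S}$ of Krein spaces is a family of bounded operators $\Psi(\alpha)\colon\mathcal K_{d(\alpha)}\to\mathcal K_{c(\alpha)}$ with $\Psi(\alpha\beta)=\Psi(\alpha)\Psi(\beta)$ (for $d(\alpha)=c(\beta)$) and $\Psi(\alpha^*)=\Psi(\alpha)^\sharp$. A minimal partial Krein space linearisation of $K$ is a bundle of Krein spaces $\{\mathcal K_s\}_{s\in S}$ with bounded operators $V_x\colon\mathcal H_x\to\mathcal K_{a(x)}$, $x\in X$, such that $K(x,y)=V_x^\sharp V_y$ whenever $a(x)=a(y)$, and each $\mathcal K_s$ is the closed linear span of $\bigcup_{x\in X_s}V_x\mathcal H_x$. A reproducing kernel Krein space with kernel $K^s$ is a Krein space $\mathcal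 R$ that is a linear subspace of $\prod_{x\in X_s}\mathcal H_x$, contains all sections $K^s_xh=K(\cdot,x)h$, and satisfies $\langle f(x),h\rangle=[f,K^s_xh]$ for all $f\in\mathcal R$, $x\in X_s$, $h\in\mathcal H_x$. Theorem. Let $K$ be a partially Hermitian kernel. The following assertions are equivalent. (1) $K$ is $\Gamma$-invariant and there is a partially positive semidefinite kernel $L$, $\Gamma$-invariant and of bounded shift type, such that $-L\le K\le L$. (2) $K$ is $\Gamma$-invariant and there is a partially positive semidefinite kernel $L$, $\Gamma$-invariant and of bounded shift type, such that $|[f,g]_K|\le[f,f]_L^{1/2}[g,g]_L^{1/2}$ for all $s\in S$ and $f,g\in\mathcal F^0(X_s;\boldsymbol H_s)$. (3) $K=K_1-K_2$ for some partially positive semidefinite kernels $K_1,K_2$, both $\Gamma$-invariant and of bounded shift type. (3') As (3), with $K_1,K_2$ disjoint in addition. (4) There are a minimal partial Krein space linearisation $(\{\mathcal K_s\}_{s\in S};\{V_x\}_{x\in X})$ of $K$, a bounded $*$-representation $\Psi$ of $\Gamma$ on $\{\mathcal K_s\}_{s\in S}$ with $\Psi(\alpha)V_x=V_{\alpha\cdot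 x}$ whenever $d(\alpha)=a(x)$, and fundamental symmetries $J_s$ of $\mathcal K_s$, $s\in S$, such that $\Psi(\alpha)J_{d(\alpha)}=J_{c(\alpha)}\Psi(\alpha)$ for all $\alpha\in\Gamma$. (5) There are a bundle $\{\mathcal R_s\}_{s\in S}$ of reproducing kernel Krein spaces $\mathcal R_s$ with kernels $K^s$, fundamental symmetries $J_s$ of $\mathcal R_s$, $s\in S$, and a bounded $*$-representation $\Phi$ of $\Gamma$ on $\{\mathcal R_s\}_{s\in S}$, such that $\Phi(\alpha)J_{d(\alpha)}=J_{c(\alpha)}\Phi(\alpha)$ for all $\alpha\in\Gamma$ and $K^{c(\alpha)}_{\alpha\cdot x}=\Phi(\alpha)K^{d(\alpha)}_x$ for all $\alpha\in\Gamma$, $x\in X_{d(\alpha)}$. -/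

import Mathlib

open scoped InnerProductSpace ComplexConjugate

universe u v w uΓ uS

namespace KreinKernel

/-! ### Hilbert spaces as bundled objects -/

/-- A Hilbert space over `𝕜`, bundled, so that equality of two Hilbert spaces makes sense. -/
structure HilbertSp (𝕜 : Type w) [RCLike 𝕜] : Type (max w (v + 1)) where
  carrier : Type v
  [normedAddCommGroup : NormedAddCommGroup carrier]
  [innerProductSpace : InnerProductSpace 𝕜 carrier]
  [completeSpace : CompleteSpace carrier]

namespace HilbertSp

variable {𝕜 : Type w} [RCLike 𝕜]

instance : CoeSort (HilbertSp.{v} 𝕜) (Type v) := ⟨HilbertSp.carrier⟩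

attribute [instance] HilbertSp.normedAddCommGroup HilbertSp.innerProductSpace
  HilbertSp.completeSpace

/-- The identity map between two equal Hilbert spaces. -/
def ident {A B : HilbertSp.{v} 𝕜} (h : A = B) : A ≃ₗᵢ[𝕜] B :=
  h ▸ LinearIsometryEquiv.refl 𝕜 A

@[simp] theorem ident_rfl {A : HilbertSp.{v} 𝕜} (x : A) : ident (rfl : A = A) x = x := rfl

end HilbertSp

/-! ### Krein spaces

Inner products are linear in the first variable and conjugate linear in the second, so the paper
convention `⟨h, k⟩` of a Hilbert space is `inner 𝕜 k h` in Mathlib. -/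

section Krein

variable {𝕜 : Type w} [RCLike 𝕜] {E : Type v} [AddCommGroup E] [Module 𝕜 E]

/-- A positive definite inner product: (conjugate) symmetric and positive on nonzero vectors. -/
structure IsPosDefInner (B : E →ₗ[𝕜] E →ₗ⋆[𝕜] 𝕜) : Prop where
  conj_symm : ∀ x y, conj (B y x) = B x y
  pos : ∀ x, x ≠ 0 → 0 < RCLike.re (B x x)

/-- The Mathlib inner product attached to a positive definite inner product. -/
@[reducible] def IsPosDefInner.core {B : E →ₗ[𝕜] E →ₗ⋆[𝕜] 𝕜} (h : IsPosDefInner B) :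
    InnerProductSpace.Core 𝕜 E where
  inner x y := B y x
  conj_inner_symm x y := h.conj_symm y x
  re_inner_nonneg x := by
    by_cases hx : x = 0
    · simp [hx]
    · exact (h.pos x hx).le
  add_left x y z := by simp
  smul_left x y r := by simp
  definite x hx := by
    by_contra hne
    have := h.pos x hne
    rw [hx] at this
    simp at this

/-- The norm `x ↦ √(B x x)` of a positive definite inner product `B`. -/
@[reducible] noncomputable def IsPosDefInner.normed {B : E →ₗ[𝕜] E →ₗ⋆[𝕜] 𝕜}
    (h : IsPosDefInner B) : NormedAddCommGroup E :=
  @InnerProductSpace.Core.toNormedAddCommGroup 𝕜 E _ _ _ h.core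

/-- `E` with the inner product `B`. -/
@[reducible] noncomputable def IsPosDefInner.innerSpace {B : E →ₗ[𝕜] E →ₗ⋆[𝕜] 𝕜}
    (h : IsPosDefInner B) : @InnerProductSpace 𝕜 E _ h.normed.toSeminormedAddCommGroup :=
  @InnerProductSpace.ofCore 𝕜 E _ _ _ h.core.toCore

/-- `(E, B)` is a Hilbert space. -/
structure IsHilbertInner (B : E →ₗ[𝕜] E →ₗ⋆[𝕜] 𝕜) : Prop where
  posDef : IsPosDefInner B
  complete : @CompleteSpace E posDef.normed.toUniformSpace

/-- `J` is a fundamental symmetry of the inner product `B`: `J² = I` and `⟨x, y⟩_J = [J x, y]`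
is a positive definite inner product that makes `E` a Hilbert space. -/
structure IsFundamentalSymmetry (B : E →ₗ[𝕜] E →ₗ⋆[𝕜] 𝕜) (J : E →ₗ[𝕜] E) : Prop where
  sq : ∀ x, J (J x) = x
  hilbert : IsHilbertInner (B.comp J)

/-- The topology of the Hilbert space `(E, ⟨·, ·⟩_J)`. -/
@[reducible] noncomputable def IsFundamentalSymmetry.topology
    {B : E →ₗ[𝕜] E →ₗ⋆[𝕜] 𝕜} {J : E →ₗ[𝕜] E} (h : IsFundamentalSymmetry B J) :
    TopologicalSpace E :=
  h.hilbert.posDef.normed.toUniformSpace.toTopologicalSpace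

/-- A Krein space inner product: (conjugate) symmetric, with some fundamental symmetry. -/
structure IsKreinInner (B : E →ₗ[𝕜] E →ₗ⋆[𝕜] 𝕜) : Prop where
  conj_symm : ∀ x y, conj (B y x) = B x y
  exists_symmetry : ∃ J : E →ₗ[𝕜] E, IsFundamentalSymmetry B J

/-- The form of a Krein space is continuous in its first variable. -/
theorem IsFundamentalSymmetry.continuous_form {B : E →ₗ[𝕜] E →ₗ⋆[𝕜] 𝕜} {J : E →ₗ[𝕜] E}
    (hB : ∀ x y, conj (B y x) = B x y) (h : IsFundamentalSymmetry B J) (y : E) :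
    @Continuous E 𝕜 h.topology _ (fun x => B x y) := by
  let := h.hilbert.posDef.normed
  let := h.hilbert.posDef.innerSpace
  have key : (fun x => B x y) = fun x => inner 𝕜 (J y) x := by
    funext x
    change B x y = B (J x) (J y)
    have h1 := h.hilbert.posDef.conj_symm x (J y)
    simp only [LinearMap.comp_apply, h.sq] at h1
    rw [← h1, hB]
  rw [key]
  exact continuous_const.inner continuous_id

/-- Any two fundamental symmetries of a Krein space give the same topology. -/
theorem IsFundamentalSymmetry.topology_le {B : E →ₗ[𝕜] E →ₗ⋆[𝕜] 𝕜} {J J' : E →ₗ[𝕜] E}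
    (hB : ∀ x y, conj (B y x) = B x y) (h : IsFundamentalSymmetry B J)
    (h' : IsFundamentalSymmetry B J') : h.topology ≤ h'.topology := by
  have key : ∀ (E₁ E₂ : Type v) [NormedAddCommGroup E₁] [NormedSpace 𝕜 E₁] [CompleteSpace E₁]
      [NormedAddCommGroup E₂] [NormedSpace 𝕜 E₂] [CompleteSpace E₂] (e : E₁ →ₗ[𝕜] E₂)
      (φ : E₂ → E₂ → 𝕜), (∀ y, Continuous fun x => φ x y) →
      (∀ y, Continuous fun x => φ (e x) y) → (∀ x z, (∀ y, φ x y = φ z y) → x = z) →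
      Continuous e := by
    intro E₁ E₂ _ _ _ _ _ _ e φ h1 h2 h3
    refine e.continuous_of_seq_closed_graph fun u x z hu hv => h3 _ _ fun y => ?_
    exact tendsto_nhds_unique (((h1 y).tendsto z).comp hv) (((h2 y).tendsto x).comp hu)
  have sep : ∀ x z : E, (∀ y, B x y = B z y) → x = z := by
    intro x z hxz
    by_contra hne
    have h1 := h.hilbert.posDef.pos (x - z) (sub_ne_zero.mpr hne)
    have h2 : B (x - z) (J (x - z)) = 0 := by
      rw [map_sub, LinearMap.sub_apply, hxz, sub_self]
    rw [LinearMap.comp_apply, ← hB, h2] at h1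
    simp at h1
  have := @key E E h.hilbert.posDef.normed h.hilbert.posDef.innerSpace.toNormedSpace
    h.hilbert.complete h'.hilbert.posDef.normed h'.hilbert.posDef.innerSpace.toNormedSpace
    h'.hilbert.complete LinearMap.id (fun x y => B x y) (h'.continuous_form hB)
    (h.continuous_form hB) sep
  exact continuous_id_iff_le.mp this

end Krein

/-- A Krein space over `𝕜`. -/
structure KreinSpace (𝕜 : Type w) [RCLike 𝕜] : Type (max w (v + 1)) where
  carrier : Type v
  [addCommGroup : AddCommGroup carrier]
  [module : Module 𝕜 carrier]
  form : carrier →ₗ[𝕜] carrier →ₗ⋆[𝕜] 𝕜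
  isKrein : IsKreinInner form

namespace KreinSpace

variable {𝕜 : Type w} [RCLike 𝕜]

instance : CoeSort (KreinSpace.{v} 𝕜) (Type v) := ⟨KreinSpace.carrier⟩

attribute [instance] KreinSpace.addCommGroup KreinSpace.module

/-- The strong topology of a Krein space: the norm topology given by a fundamental symmetry. It
does not depend on the fundamental symmetry, see `strongTopology_eq`. With this instance,
`K₁ →L[𝕜] K₂` is the space `𝓑(K₁, K₂)` of bounded linear operators. -/
noncomputable instance strongTopology (K : KreinSpace.{v} 𝕜) : TopologicalSpace K :=
  K.isKrein.exists_symmetry.choose_spec.topology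

theorem strongTopology_eq (K : KreinSpace.{v} 𝕜) {J : K →ₗ[𝕜] K}
    (h : IsFundamentalSymmetry K.form J) : K.strongTopology = h.topology :=
  le_antisymm (IsFundamentalSymmetry.topology_le K.isKrein.conj_symm
    K.isKrein.exists_symmetry.choose_spec h)
    (IsFundamentalSymmetry.topology_le K.isKrein.conj_symm h
    K.isKrein.exists_symmetry.choose_spec)

/-- `T'` is the Krein space adjoint `T^♯` of `T`. -/
def IsAdjoint {K₁ K₂ : KreinSpace.{v} 𝕜} (T : K₁ →L[𝕜] K₂) (T' : K₂ →L[𝕜] K₁) : Prop :=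
  ∀ x y, K₂.form (T x) y = K₁.form x (T' y)

end KreinSpace

/-! ### `*`-semigroupoids, actions and representations -/

/-- A `*`-semigroupoid (not necessarily with unit) with set of symbols `S`. -/
structure StarSemigroupoid (Γ : Type uΓ) (S : Type uS) where
  d : Γ → S
  c : Γ → S
  mul : ∀ α β : Γ, d α = c β → Γ
  d_mul : ∀ α β h, d (mul α β h) = d β
  c_mul : ∀ α β h, c (mul α β h) = c α
  mul_assoc : ∀ (α β γ : Γ) (h₁ : d α = c β) (h₂ : d β = c γ),
    mul α (mul β γ h₂) (h₁.trans (c_mul β γ h₂).symm) =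
      mul (mul α β h₁) γ ((d_mul α β h₁).trans h₂)
  star : Γ → Γ
  d_star : ∀ α, d (star α) = c α
  c_star : ∀ α, c (star α) = d α
  star_mul : ∀ (α β : Γ) (h : d α = c β),
    star (mul α β h) = mul (star β) (star α) ((d_star β).trans (h.symm.trans (c_star α).symm))
  star_star : ∀ α, star (star α) = α

namespace StarSemigroupoid

variable {Γ : Type uΓ} {S : Type uS} (G : StarSemigroupoid Γ S)

/-- The fibre `Γ_s^t` of all elements with domain `s` and codomain `t`. -/
abbrev Fib (s t : S) : Type uΓ := {α : Γ // G.d α = s ∧ G.c α = t}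

variable {G} {r s t : S}

/-- The product `Γ_s^t × Γ_r^s → Γ_r^t`. -/
def Fib.mul (α : G.Fib s t) (β : G.Fib r s) : G.Fib r t :=
  ⟨G.mul α.1 β.1 (α.2.1.trans β.2.2.symm),
    (G.d_mul _ _ _).trans β.2.1, (G.c_mul _ _ _).trans α.2.2⟩

/-- The involution `Γ_s^t → Γ_t^s`. -/
def Fib.star (α : G.Fib s t) : G.Fib t s :=
  ⟨G.star α.1, (G.d_star _).trans α.2.2, (G.c_star _).trans α.2.1⟩

end StarSemigroupoid

/-- A left action of a semigroupoid on a set `X`. -/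
structure LeftAction {Γ : Type uΓ} {S : Type uS} (G : StarSemigroupoid Γ S) (X : Type u) where
  anchor : X → S
  anchor_surjective : Function.Surjective anchor
  act : ∀ (α : Γ) (x : X), G.d α = anchor x → X
  anchor_act : ∀ α x h, anchor (act α x h) = G.c α
  mul_act : ∀ (α β : Γ) (x : X) (h₁ : G.d α = G.c β) (h₂ : G.d β = anchor x),
    act (G.mul α β h₁) x ((G.d_mul α β h₁).trans h₂) =
      act α (act β x h₂) (h₁.trans (anchor_act β x h₂).symm)

namespace LeftAction

variable {Γ : Type uΓ} {S : Type uS} {G : StarSemigroupoid Γ S} {X : Type u} (A : LeftAction G X)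

/-- The block `X_s = a⁻¹({s})` of the partition of `X` given by the anchor map. -/
abbrev Block (s : S) : Type u := {x : X // A.anchor x = s}

/-- The action `Γ_s^t × X_s → X_t`. -/
def smul {s t : S} (α : G.Fib s t) (x : A.Block s) : A.Block t :=
  ⟨A.act α.1 x.1 (α.2.1.trans x.2.symm), (A.anchor_act _ _ _).trans α.2.2⟩

end LeftAction

/-- A `*`-representation `(Id_S, Ψ)` of a `*`-semigroupoid by bounded operators on a bundle of
Krein spaces indexed by its set of symbols. -/
structure StarRep {Γ : Type uΓ} {S : Type uS} (G : StarSemigroupoid Γ S) {𝕜 : Type w} [RCLike 𝕜]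
    (K : S → KreinSpace.{v} 𝕜) where
  op : ∀ {s t : S}, G.Fib s t → (K s →L[𝕜] K t)
  map_mul : ∀ {r s t : S} (α : G.Fib s t) (β : G.Fib r s), op (α.mul β) = (op α).comp (op β)
  map_star : ∀ {s t : S} (α : G.Fib s t), KreinSpace.IsAdjoint (op α) (op α.star)

/-! ### Operator valued kernels -/

section Kernels

variable {𝕜 : Type w} [RCLike 𝕜] {Y : Type u}

/-- An operator valued kernel: `K(x, y)` is a bounded operator `H_y → H_x`. -/
abbrev OpKernel (H : Y → HilbertSp.{v} 𝕜) : Type (max u v) := ∀ x y : Y, H y →L[𝕜] H x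

/-- Sections of finite support. -/
abbrev FinSection (H : Y → HilbertSp.{v} 𝕜) : Type (max u v) := Π₀ x : Y, (H x : Type v)

namespace OpKernel

variable {H : Y → HilbertSp.{v} 𝕜}

open Classical in
/-- `[f, g]_K = ∑_{x, y} ⟨K(y, x) f(x), g(y)⟩`. -/
noncomputable def form (K : OpKernel H) (f g : FinSection H) : 𝕜 :=
  f.sum fun x h => g.sum fun y k => inner 𝕜 k (K y x h)

/-- Hermitian kernels. -/
def IsHermitian (K : OpKernel H) : Prop :=
  ∀ x y, ContinuousLinearMap.adjoint (K x y) = K y x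

/-- Positive semidefinite kernels. -/
structure IsPosSemidef (K : OpKernel H) : Prop where
  isHermitian : K.IsHermitian
  nonneg : ∀ f : FinSection H, 0 ≤ RCLike.re (K.form f f)

/-- The restriction of a kernel to the points of a subset. -/
def restrict (K : OpKernel H) (p : Y → Prop) : OpKernel (fun x : {x : Y // p x} => H x.1) :=
  fun x y => K x.1 y.1

/-- The section `K_x h = K(·, x) h`. -/
def column (K : OpKernel H) (x : Y) (h : H x) : ∀ y : Y, (H y : Type v) := fun y => K y x h

end OpKernel

/-- A reproducing kernel Krein space with reproducing kernel `K`. -/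
structure RKKreinSpace {H : Y → HilbertSp.{v} 𝕜} (K : OpKernel H) where
  space : Submodule 𝕜 (∀ y : Y, (H y : Type v))
  form : space →ₗ[𝕜] space →ₗ⋆[𝕜] 𝕜
  isKrein : IsKreinInner form
  column_mem : ∀ (x : Y) (h : H x), K.column x h ∈ space
  reproducing : ∀ (f : space) (x : Y) (h : H x),
    inner 𝕜 h (f.1 x) = form f ⟨K.column x h, column_mem x h⟩

namespace RKKreinSpace

variable {H : Y → HilbertSp.{v} 𝕜} {K : OpKernel H}

/-- The underlying Krein space. -/
@[reducible] def toKreinSpace (R : RKKreinSpace K) : KreinSpace.{max u v} 𝕜 where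
  carrier := R.space
  form := R.form
  isKrein := R.isKrein

/-- `K_x h` as an element of the reproducing kernel space. -/
def col (R : RKKreinSpace K) (x : Y) (h : H x) : R.toKreinSpace :=
  (⟨K.column x h, R.column_mem x h⟩ : R.space)

end RKKreinSpace

end Kernels

/-! ### Kernels on a set with an action -/

section Partial

variable {𝕜 : Type w} [RCLike 𝕜] {Γ : Type uΓ} {S : Type uS} {G : StarSemigroupoid Γ S}
  {X : Type u} (A : LeftAction G X) {H : X → HilbertSp.{v} 𝕜}

/-- The restriction `K^s` of `K` to `X_s × X_s`. -/
abbrev OpKernel.block (K : OpKernel H) (s : S) : OpKernel (fun x : A.Block s => H x.1) :=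
  K.restrict (fun x => A.anchor x = s)

/-- Partially Hermitian kernels. -/
def IsPartiallyHermitian (K : OpKernel H) : Prop := ∀ s, (K.block A s).IsHermitian

/-- Partially positive semidefinite kernels. -/
def IsPartiallyPosSemidef (K : OpKernel H) : Prop := ∀ s, (K.block A s).IsPosSemidef

/-- `L` partially dominates `K`. -/
def PartialLE (K L : OpKernel H) : Prop := IsPartiallyPosSemidef A (L - K)

/-- Disjointness of partially positive semidefinite kernels. -/
def AreDisjoint (L₁ L₂ : OpKernel H) : Prop :=
  ∀ L : OpKernel H, IsPartiallyPosSemidef A L → PartialLE A L L₁ → PartialLE A L L₂ →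
    ∀ s, L.block A s = 0

variable (H) in
/-- The Hilbert spaces are the same along every orbit: `H_{α·x} = H_x`. -/
def ConstantOnOrbits : Prop :=
  ∀ {s t : S} (α : G.Fib s t) (x : A.Block s), H (A.smul α x).1 = H x.1

variable {A}

/-- `K` is `Γ`-invariant: `K(α·x, y) = K(x, α*·y)`, where `H_{α·x} = H_x` and `H_{α*·y} = H_y`. -/
def IsGammaInvariant (hH : ConstantOnOrbits A H) (K : OpKernel H) : Prop :=
  ∀ {s t : S} (α : G.Fib s t) (x : A.Block s) (y : A.Block t) (k : H y.1),
    HilbertSp.ident (hH α x) (K (A.smul α x).1 y.1 k) =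
      K x.1 (A.smul α.star y).1 (HilbertSp.ident (hH α.star y).symm k)

/-- The kernel `(x, y) ↦ K(α·x, α·y)` on `X_{d(α)}`, with values in `𝓑(H_y, H_x)` by
`H_{α·x} = H_x` and `H_{α·y} = H_y`. -/
noncomputable def OpKernel.shift (hH : ConstantOnOrbits A H) (K : OpKernel H) {s t : S}
    (α : G.Fib s t) : OpKernel (fun x : A.Block s => H x.1) :=
  fun x y =>
    (HilbertSp.ident (hH α x)).toContinuousLinearEquiv.toContinuousLinearMap.comp
      ((K (A.smul α x).1 (A.smul α y).1).comp
        (HilbertSp.ident (hH α y).symm).toContinuousLinearEquiv.toContinuousLinearMap)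

/-- `K` is of bounded shift type. -/
def IsBoundedShift (hH : ConstantOnOrbits A H) (K : OpKernel H) : Prop :=
  ∀ {s t : S} (α : G.Fib s t), ∃ M : ℝ, 0 ≤ M ∧
    ∀ g : FinSection (fun x : A.Block s => H x.1),
      RCLike.re ((K.shift hH α).form g g) ≤ M * RCLike.re ((K.block A s).form g g)

variable (A)

/-- A Krein space partial linearisation `(K; V)` of a kernel: bounded operators
`V_x : H_x → K_{a(x)}` with `K(x, y) = V_x^♯ V_y` whenever `a(x) = a(y)`. -/
structure PartialLinearisation (K : OpKernel H) where
  space : S → KreinSpace.{max u v} 𝕜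
  V : ∀ {s : S} (x : A.Block s), (H x.1 →L[𝕜] space s)
  factor : ∀ {s : S} (x y : A.Block s) (h : H x.1) (k : H y.1),
    inner 𝕜 h (K x.1 y.1 k) = (space s).form (V y k) (V x h)

variable {A}

/-- Minimality: each `K_s` is the closed span of the ranges of the `V_x` with `a(x) = s`. -/
def PartialLinearisation.IsMinimal {K : OpKernel H} (L : PartialLinearisation A K) : Prop :=
  ∀ s : S, Dense
    (Submodule.span 𝕜 {v : L.space s | ∃ (x : A.Block s) (h : H x.1), L.V x h = v} :
      Set (L.space s))

end Partial

end KreinKernel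

open KreinKernel

namespace KreinKernel

namespace HilbertSp

variable {𝕜 : Type w} [RCLike 𝕜]

/-! A dominating positive kernel `L` provides a Hilbert space picture in which `K` becomes a bounded
symmetric operator commuting with the semigroupoid; the spectral structure of that operator gives
everything else.

The Kolmogorov decomposition `L(x, y) = V_x^* V_y` on each block produces Hilbert spaces `E_s`.
Bounded shift makes `V_x h ↦ V_{α·x} h` bounded and invariance makes it a `*`-representation
(`exists_hilbertSystem`). The Schwarz-type bound gives symmetric contractions `T_s` with `K(x, y) =
V_x^* T_s V_y`, and invariance of `K` makes `T` intertwine the representation. Write `T = Z (2 P -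
1) Z`, where `Z² = |T|` and `P` projects on `ker (|T| - T)`. Both `Z` and `P` are natural in `T`, so
they commute with the representation as well (`exists_polarSystem`).

The kernels built from `P Z V_x` and `(1 - P) Z V_x` are the positive and negative parts of `K`, and
orthogonality of the two ranges makes them disjoint. On `(ker Z)ᗮ` the operators `Z V_x` have total
range and `2 P - 1` is a symmetry; functions `y ↦ V_y^* Z (2 P - 1) a` then form the reproducing
kernel Krein spaces, whose columns give a minimal linearisation.

Conversely, a fundamental symmetry commuting with the representation turns it into a Hilbert space
`*`-representation, and the projections `(1 ± J) / 2` split `K`. A splitting `K₁ - K₂` is dominated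
by `K₁ + K₂`, and two-sided domination gives the Schwarz-type bound (`OpKernel.norm_form_le`), which
closes the circle. -/

theorem inner_ident {A B : HilbertSp.{v} 𝕜} (h : A = B) (x : A) (y : B) :
    inner 𝕜 y (ident h x) = inner 𝕜 (ident h.symm y) x := by
  subst h; rfl

@[simp] theorem ident_ident {A B C : HilbertSp.{v} 𝕜} (h : A = B) (h' : B = C) (x : A) :
    ident h' (ident h x) = ident (h.trans h') x := by
  subst h h'; rfl

end HilbertSp

/-! ### Kernel forms on finitely supported sections, Kolmogorov decomposition, representing
operators. -/

section Synthesis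

variable {𝕜 : Type w} [RCLike 𝕜] {Y : Type u} {H : Y → HilbertSp.{v} 𝕜}
  {E : Type*} [NormedAddCommGroup E] [InnerProductSpace 𝕜 E]

open Classical in
/-- The synthesis map `f ↦ ∑ x, V x (f x)` on sections of finite support. -/
noncomputable def synthesis (V : ∀ y, H y →L[𝕜] E) : FinSection H →ₗ[𝕜] E :=
  DFinsupp.lsum ℕ fun y => (V y).toLinearMap

open Classical in
theorem synthesis_apply (V : ∀ y, H y →L[𝕜] E) (f : FinSection H) :
    synthesis V f = f.sum fun y h => V y h := by
  simp [synthesis, DFinsupp.lsum_apply_apply, DFinsupp.sumAddHom_apply]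

@[simp] theorem synthesis_single [inst : DecidableEq Y] (V : ∀ y, H y →L[𝕜] E) (y : Y) (h : H y) :
    synthesis V (DFinsupp.single y h) = V y h := by
  obtain rfl : inst = fun a b => Classical.propDecidable (a = b) := Subsingleton.elim _ _
  simp [synthesis]

theorem synthesis_comp {F : Type*} [NormedAddCommGroup F] [InnerProductSpace 𝕜 F]
    (V : ∀ y, H y →L[𝕜] E) (T : E →L[𝕜] F) (f : FinSection H) :
    synthesis (fun y => T.comp (V y)) f = T (synthesis V f) := by
  classical
  simp [synthesis_apply, DFinsupp.sum, map_sum]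

namespace OpKernel

variable (K L : OpKernel H)

theorem form_add_left (f f' g : FinSection H) : K.form (f + f') g = K.form f g + K.form f' g := by
  classical
  unfold form
  refine DFinsupp.sum_add_index ?_ ?_
  · intro x; simp [DFinsupp.sum]
  · intro x h h'; simp [DFinsupp.sum, inner_add_right, Finset.sum_add_distrib]

theorem form_smul_left (c : 𝕜) (f g : FinSection H) : K.form (c • f) g = c * K.form f g := by
  classical
  unfold form
  -- The support shrinks when `c = 0`, so the sum is taken over the support of `f`.
  rw [DFinsupp.sum, Finset.sum_subset (DFinsupp.support_smul c f)]
  · simp [DFinsupp.sum, inner_smul_right, Finset.mul_sum]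
  · intro x _ hx
    rw [DFinsupp.notMem_support_iff] at hx
    simp [hx, DFinsupp.sum]

theorem form_add_right (f g g' : FinSection H) : K.form f (g + g') = K.form f g + K.form f g' := by
  classical
  unfold form
  rw [← DFinsupp.sum_add]
  congr 1; ext x h
  refine DFinsupp.sum_add_index ?_ ?_
  · intro x; simp
  · intro x h h'; simp [inner_add_left]

theorem form_smul_right (c : 𝕜) (f g : FinSection H) :
    K.form f (c • g) = conj c * K.form f g := by
  classical
  unfold form
  rw [DFinsupp.sum, DFinsupp.sum, Finset.mul_sum]
  refine Finset.sum_congr rfl fun x _ => ?_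
  rw [DFinsupp.sum, Finset.sum_subset (DFinsupp.support_smul c g)]
  · simp [DFinsupp.sum, inner_smul_left, Finset.mul_sum]
  · intro y _ hy
    rw [DFinsupp.notMem_support_iff] at hy
    simp [hy]

theorem form_add (f g : FinSection H) : (K + L).form f g = K.form f g + L.form f g := by
  classical
  simp [form, DFinsupp.sum, inner_add_right, Finset.sum_add_distrib]

theorem form_neg (f g : FinSection H) : (-K).form f g = -K.form f g := by
  classical
  simp [form, DFinsupp.sum]

theorem form_sub (f g : FinSection H) : (K - L).form f g = K.form f g - L.form f g := by
  rw [sub_eq_add_neg, form_add, form_neg, sub_eq_add_neg]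

@[simp] theorem form_single [inst : DecidableEq Y] (x y : Y) (h : H x) (k : H y) :
    K.form (DFinsupp.single x h) (DFinsupp.single y k) = inner 𝕜 k (K y x h) := by
  obtain rfl : inst = fun a b => Classical.propDecidable (a = b) := Subsingleton.elim _ _
  classical
  unfold form
  rw [DFinsupp.sum_single_index (by simp [DFinsupp.sum]), DFinsupp.sum_single_index (by simp)]

variable {K L}

theorem IsHermitian.inner_eq (hK : K.IsHermitian) (x y : Y) (h : H x) (k : H y) :
    inner 𝕜 h (K x y k) = inner 𝕜 (K y x h) k := by
  rw [← hK x y, ContinuousLinearMap.adjoint_inner_left]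

theorem isHermitian_of_inner (hK : ∀ x y h k, inner 𝕜 h (K x y k) = inner 𝕜 (K y x h) k) :
    K.IsHermitian := fun x y => by
  symm
  rw [ContinuousLinearMap.eq_adjoint_iff]
  intro a b
  rw [← hK]

theorem IsHermitian.conj_form (hK : K.IsHermitian) (f g : FinSection H) :
    conj (K.form g f) = K.form f g := by
  classical
  unfold form DFinsupp.sum
  rw [map_sum, Finset.sum_comm]
  simp only [map_sum]
  refine Finset.sum_congr rfl fun x _ => Finset.sum_congr rfl fun y _ => ?_
  rw [inner_conj_symm, hK.inner_eq]

theorem IsHermitian.add (hK : K.IsHermitian) (hL : L.IsHermitian) : (K + L).IsHermitian :=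
  fun x y => by simp [hK x y, hL x y]

theorem IsPosSemidef.add (hK : K.IsPosSemidef) (hL : L.IsPosSemidef) : (K + L).IsPosSemidef where
  isHermitian := hK.1.add hL.1
  nonneg f := by
    rw [form_add, map_add]
    exact add_nonneg (hK.2 f) (hL.2 f)

theorem form_eq_inner (V : ∀ y, H y →L[𝕜] E) (T : E →L[𝕜] E)
    (hK : ∀ x y h k, inner 𝕜 h (K x y k) = inner 𝕜 (V x h) (T (V y k))) (f g : FinSection H) :
    K.form f g = inner 𝕜 (synthesis V g) (T (synthesis V f)) := by
  classical
  simp only [form, synthesis_apply, DFinsupp.sum, hK, map_sum, sum_inner, inner_sum]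

theorem form_self_eq_norm_sq (V : ∀ y, H y →L[𝕜] E)
    (hK : ∀ x y h k, inner 𝕜 h (K x y k) = inner 𝕜 (V x h) (V y k)) (f : FinSection H) :
    RCLike.re (K.form f f) = ‖synthesis V f‖ ^ 2 := by
  rw [form_eq_inner V (ContinuousLinearMap.id 𝕜 E) hK]
  simp

theorem isPosSemidef_of_factor (V : ∀ y, H y →L[𝕜] E)
    (hK : ∀ x y h k, inner 𝕜 h (K x y k) = inner 𝕜 (V x h) (V y k)) : K.IsPosSemidef where
  isHermitian := isHermitian_of_inner fun x y h k => by
    rw [hK, ← inner_conj_symm, ← hK, inner_conj_symm]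
  nonneg f := by
    rw [form_self_eq_norm_sq V hK]; positivity

/-- The semi-inner product on sections of finite support given by a positive semidefinite
kernel. -/
@[reducible] noncomputable def IsPosSemidef.core (hL : L.IsPosSemidef) :
    PreInnerProductSpace.Core 𝕜 (FinSection H) where
  inner f g := L.form g f
  conj_inner_symm _ _ := hL.1.conj_form _ _
  re_inner_nonneg f := hL.2 f
  add_left _ _ _ := L.form_add_right _ _ _
  smul_left _ _ _ := L.form_smul_right _ _ _

/-- The Kolmogorov decomposition of a positive semidefinite kernel. -/
theorem IsPosSemidef.exists_factor (hL : L.IsPosSemidef) :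
    ∃ (E : HilbertSp.{max u v} 𝕜) (V : ∀ y, H y →L[𝕜] E),
      (∀ x y h k, inner 𝕜 h (L x y k) = inner 𝕜 (V x h) (V y k)) ∧
        DenseRange (synthesis V) := by
  classical
  let c := hL.core
  let := @InnerProductSpace.Core.toSeminormedAddCommGroup 𝕜 (FinSection H) _ _ _ c
  let : InnerProductSpace 𝕜 (FinSection H) := InnerProductSpace.ofCore c
  -- The form may be degenerate; the completion is the Hausdorff one, so null sections are divided
  -- out here.
  let ι : FinSection H →L[𝕜] UniformSpace.Completion (FinSection H) :=
    UniformSpace.Completion.toComplL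
  have hinner : ∀ f g : FinSection H, inner 𝕜 (ι f) (ι g) = L.form g f := fun f g =>
    UniformSpace.Completion.inner_coe f g
  have hsingle : ∀ (y : Y) (h : H y),
      ‖ι (DFinsupp.single y h)‖ ^ 2 ≤ ‖L y y‖ * ‖h‖ ^ 2 := by
    intro y h
    rw [← inner_self_eq_norm_sq (𝕜 := 𝕜), hinner, form_single]
    calc _ ≤ ‖inner 𝕜 h (L y y h)‖ := RCLike.re_le_norm _
      _ ≤ ‖h‖ * ‖L y y h‖ := norm_inner_le_norm _ _
      _ ≤ ‖h‖ * (‖L y y‖ * ‖h‖) := by gcongr; exact (L y y).le_opNorm h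
      _ = _ := by ring
  let V : ∀ y, H y →L[𝕜] UniformSpace.Completion (FinSection H) := fun y =>
    (ι.toLinearMap.comp (DFinsupp.lsingle y)).mkContinuous (√‖L y y‖) fun h => by
      refine abs_le_of_sq_le_sq' ?_ (by positivity) |>.2
      rw [mul_pow, Real.sq_sqrt (norm_nonneg _)]
      exact hsingle y h
  have hV : ∀ y h, V y h = ι (DFinsupp.single y h) := fun y h => rfl
  have hsyn : ∀ f, synthesis V f = ι f := by
    intro f
    have : synthesis V = ι.toLinearMap := by
      refine DFinsupp.lhom_ext fun y h => ?_
      rw [synthesis_single, hV]; rfl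
    rw [this]; rfl
  refine ⟨⟨UniformSpace.Completion (FinSection H)⟩, V, fun x y h k => ?_, ?_⟩
  · rw [hV, hV, hinner, form_single]
  · have : (synthesis V : FinSection H → _) = ι := funext hsyn
    change DenseRange (synthesis V : FinSection H → UniformSpace.Completion (FinSection H))
    rw [this]
    exact UniformSpace.Completion.denseRange_coe

/-- A bounded sesquilinear form with respect to a dense map is given by a contraction. -/
theorem exists_contraction [CompleteSpace E] {V : ∀ y, H y →L[𝕜] E}
    (hV : DenseRange (synthesis V))
    (hK : ∀ f g, ‖K.form f g‖ ≤ ‖synthesis V f‖ * ‖synthesis V g‖) :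
    ∃ T : E →L[𝕜] E, ‖T‖ ≤ 1 ∧
      ∀ x y h k, inner 𝕜 (V x h) (T (V y k)) = inner 𝕜 h (K x y k) := by
  classical
  let φ : FinSection H → FinSection H →ₗ[𝕜] 𝕜 := fun g =>
    { toFun := fun f => K.form f g
      map_add' := fun f f' => K.form_add_left f f' g
      map_smul' := fun c f => K.form_smul_left c f g }
  have hφ : ∀ g f, ‖φ g f‖ ≤ ‖synthesis V g‖ * ‖synthesis V f‖ := fun g f => by
    rw [mul_comm]; exact hK f g
  let b : FinSection H → E := fun g =>
    (InnerProductSpace.toDual 𝕜 E).symm ((φ g).extendOfNorm (synthesis V))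
  have hb : ∀ g f, inner 𝕜 (b g) (synthesis V f) = K.form f g := fun g f => by
    simp only [b, InnerProductSpace.toDual_symm_apply]
    exact LinearMap.extendOfNorm_eq hV ⟨_, hφ g⟩ f
  have hbn : ∀ g, ‖b g‖ ≤ 1 * ‖synthesis V g‖ := fun g => by
    simp only [b, LinearIsometryEquiv.norm_map, one_mul]
    exact LinearMap.opNorm_extendOfNorm_le hV (norm_nonneg _) (hφ g)
  have ext : ∀ a a' : E, (∀ f, inner 𝕜 a (synthesis V f) = inner 𝕜 a' (synthesis V f)) →
      a = a' := fun a a' h => by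
    refine ext_inner_right 𝕜 fun z => ?_
    refine hV.induction_on z (isClosed_eq (by fun_prop) (by fun_prop)) h
  let B : FinSection H →ₗ[𝕜] E :=
    { toFun := b
      map_add' := fun g g' => ext _ _ fun f => by
        rw [inner_add_left, hb, hb, hb, form_add_right]
      map_smul' := fun c g => ext _ _ fun f => by
        rw [RingHom.id_apply, inner_smul_left, hb, hb, form_smul_right] }
  -- The bound `hbn` forces `B` to vanish on the kernel of the synthesis map, so `B` descends to its
  -- dense range and extends.
  let T := B.extendOfNorm (synthesis V)
  have hT : ∀ g, T (synthesis V g) = b g := fun g => LinearMap.extendOfNorm_eq hV ⟨1, hbn⟩ g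
  have hTn : ‖T‖ ≤ 1 := LinearMap.opNorm_extendOfNorm_le hV zero_le_one hbn
  -- `T` carries the kernel on the left of the inner product; since `K` is not assumed Hermitian
  -- here, the adjoint is the operator wanted.
  refine ⟨ContinuousLinearMap.adjoint T, by simpa using hTn, fun x y h k => ?_⟩
  rw [ContinuousLinearMap.adjoint_inner_right, ← synthesis_single V, ← synthesis_single V, hT,
    hb, form_single]

end OpKernel

end Synthesis

/-! ### Vectors and operators determined on a dense synthesis range. -/

section Dense

variable {𝕜 : Type w} [RCLike 𝕜] {Y : Type u} {H : Y → HilbertSp.{v} 𝕜}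
  {E : Type*} [NormedAddCommGroup E] [InnerProductSpace 𝕜 E] {V : ∀ y, H y →L[𝕜] E}

theorem eq_of_inner_eq (hV : DenseRange (synthesis V)) {a b : E}
    (hab : ∀ y h, inner 𝕜 (V y h) a = inner 𝕜 (V y h) b) : a = b := by
  classical
  refine ext_inner_left 𝕜 fun z => ?_
  refine hV.induction_on z (isClosed_eq (by fun_prop) (by fun_prop)) fun f => ?_
  simp only [synthesis_apply, DFinsupp.sum, sum_inner, hab]

theorem clm_ext_of_dense (hV : DenseRange (synthesis V)) {F : Type*} [NormedAddCommGroup F]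
    [InnerProductSpace 𝕜 F] {T T' : E →L[𝕜] F} (h : ∀ y h, T (V y h) = T' (V y h)) : T = T' := by
  classical
  ext z
  refine hV.induction_on z (isClosed_eq (by fun_prop) (by fun_prop)) fun f => ?_
  simp only [synthesis_apply, DFinsupp.sum, map_sum, h]

/-- Needed because `(αβ)·x` and `α·(β·x)` are equal points, but `V` at them has different domain
types. -/
theorem apply_eq_of_eq {y y' : Y} (e : y = y') (h : H y) :
    V y h = V y' (HilbertSp.ident (congrArg H e) h) := by
  subst e; rfl

end Dense

/-! ### Invariant kernels of bounded shift type and Hilbert space `*`-representations. -/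

section Systems

variable {𝕜 : Type w} [RCLike 𝕜] {Γ : Type uΓ} {S : Type uS} {G : StarSemigroupoid Γ S}
  {X : Type u} {A : LeftAction G X} {H : X → HilbertSp.{v} 𝕜}

theorem StarSemigroupoid.Fib.star_star {s t : S} (α : G.Fib s t) : α.star.star = α :=
  Subtype.ext (G.star_star α.1)

theorem LeftAction.mul_smul {r s t : S} (α : G.Fib s t) (β : G.Fib r s) (x : A.Block r) :
    A.smul (α.mul β) x = A.smul α (A.smul β x) :=
  Subtype.ext (A.mul_act _ _ _ _ _)

open Classical in
/-- The kernel with prescribed restrictions to the blocks, zero off the blocks. -/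
noncomputable def OpKernel.ofBlocks (A : LeftAction G X)
    (B : ∀ s, OpKernel (fun x : A.Block s => H x.1)) : OpKernel H := fun x y =>
  if h : A.anchor x = A.anchor y then B (A.anchor y) ⟨x, h⟩ ⟨y, rfl⟩ else 0

theorem OpKernel.ofBlocks_apply (B : ∀ s, OpKernel (fun x : A.Block s => H x.1)) {s : S}
    (x y : A.Block s) : OpKernel.ofBlocks A B x.1 y.1 = B s x y := by
  obtain ⟨x, hx⟩ := x
  obtain ⟨y, hy⟩ := y
  subst hy
  simp [ofBlocks, hx]

theorem IsGammaInvariant.add {hH : ConstantOnOrbits A H} {K L : OpKernel H}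
    (hK : IsGammaInvariant hH K) (hL : IsGammaInvariant hH L) : IsGammaInvariant hH (K + L) :=
  fun α x y k => by simp [hK α x y k, hL α x y k]

theorem IsGammaInvariant.sub {hH : ConstantOnOrbits A H} {K L : OpKernel H}
    (hK : IsGammaInvariant hH K) (hL : IsGammaInvariant hH L) : IsGammaInvariant hH (K - L) :=
  fun α x y k => by simp [hK α x y k, hL α x y k]

theorem IsGammaInvariant.inner_eq {hH : ConstantOnOrbits A H} {K : OpKernel H}
    (hK : IsGammaInvariant hH K) {s t : S} (α : G.Fib s t) (x : A.Block s) (y : A.Block t)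
    (h : H x.1) (k : H y.1) :
    inner 𝕜 (HilbertSp.ident (hH α x).symm h) (K (A.smul α x).1 y.1 k) =
      inner 𝕜 h (K x.1 (A.smul α.star y).1 (HilbertSp.ident (hH α.star y).symm k)) := by
  rw [← hK, HilbertSp.inner_ident]

/-- A bundle of Hilbert spaces with bounded operators `V_x : H_x → E_{a(x)}` and a bounded
`*`-representation of the semigroupoid with `α V_x = V_{α·x}`. -/
structure HilbertSystem (hH : ConstantOnOrbits A H) where
  space : S → HilbertSp.{max u v} 𝕜
  V : ∀ {s : S} (x : A.Block s), H x.1 →L[𝕜] space s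
  op : ∀ {s t : S}, G.Fib s t → (space s →L[𝕜] space t)
  op_mul : ∀ {r s t : S} (α : G.Fib s t) (β : G.Fib r s) (u : space r),
    op (α.mul β) u = op α (op β u)
  op_star : ∀ {s t : S} (α : G.Fib s t) (u : space s) (v : space t),
    inner 𝕜 (op α u) v = inner 𝕜 u (op α.star v)
  op_V : ∀ {s t : S} (α : G.Fib s t) (x : A.Block s) (h : H x.1),
    op α (V x h) = V (A.smul α x) (HilbertSp.ident (hH α x).symm h)

namespace HilbertSystem

variable {hH : ConstantOnOrbits A H} (D : HilbertSystem hH)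

/-- Minimality: the ranges of the `V_x` span dense subspaces. -/
def IsMinimal : Prop := ∀ s, DenseRange (synthesis fun x : A.Block s => D.V x)

/-- `L(x, y) = V_x^* V_y` on the blocks. -/
def Factors (L : OpKernel H) : Prop :=
  ∀ (s : S) (x y : A.Block s) (h : H x.1) (k : H y.1),
    inner 𝕜 h (L x.1 y.1 k) = inner 𝕜 (D.V x h) (D.V y k)

variable {D}

theorem op_star_left {s t : S} (α : G.Fib s t) (u : D.space t) (v : D.space s) :
    inner 𝕜 (D.op α.star u) v = inner 𝕜 u (D.op α v) := by
  rw [D.op_star, StarSemigroupoid.Fib.star_star]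

theorem Factors.isPartiallyPosSemidef {L : OpKernel H} (hL : D.Factors L) :
    IsPartiallyPosSemidef A L :=
  fun s => OpKernel.isPosSemidef_of_factor (fun x : A.Block s => D.V x) (hL s)

theorem Factors.isGammaInvariant {L : OpKernel H} (hL : D.Factors L) :
    IsGammaInvariant hH L := by
  intro s t α x y k
  refine ext_inner_left 𝕜 fun h => ?_
  rw [HilbertSp.inner_ident, hL t (A.smul α x) y, hL s x (A.smul α.star y), ← D.op_V, ← D.op_V,
    D.op_star]

/-- The shifted kernel factors through `D.op α ∘ V_x`, so the square of the operator norm of `D.op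
α` is a shift constant. -/
theorem Factors.isBoundedShift {L : OpKernel H} (hL : D.Factors L) : IsBoundedShift hH L := by
  intro s t α
  refine ⟨‖D.op α‖ ^ 2, by positivity, fun g => ?_⟩
  rw [OpKernel.form_self_eq_norm_sq (K := L.block A s) (fun x : A.Block s => D.V x) (hL s),
    OpKernel.form_self_eq_norm_sq (fun x : A.Block s => (D.op α).comp (D.V x)), synthesis_comp,
    ← mul_pow]
  · gcongr
    exact (D.op α).le_opNorm _
  · intro x y h k
    simp only [OpKernel.shift, ContinuousLinearMap.comp_apply, D.op_V]
    rw [← hL t]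
    exact HilbertSp.inner_ident _ _ _

/-- Compress the operators `V_x` by operators commuting with the representation. -/
def compress (D : HilbertSystem hH) (C : ∀ s, D.space s →L[𝕜] D.space s)
    (hC : ∀ {s t : S} (α : G.Fib s t) (u : D.space s), D.op α (C s u) = C t (D.op α u)) :
    HilbertSystem hH where
  space := D.space
  V x := (C _).comp (D.V x)
  op := D.op
  op_mul := D.op_mul
  op_star := D.op_star
  op_V α x h := by simp [hC, D.op_V]

end HilbertSystem

/-- In the Kolmogorov spaces of the blocks, bounded shift reads `‖∑ V_{α·x} g_x‖² ≤ M ‖∑ V_x g_x‖²`,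
so `V_x h ↦ V_{α·x} h` extends to a bounded operator. Invariance identifies its adjoint with the
operator of `α*`, and multiplicativity is checked on the vectors `V_x h`. -/
theorem exists_hilbertSystem {hH : ConstantOnOrbits A H} {L : OpKernel H}
    (hpos : IsPartiallyPosSemidef A L) (hinv : IsGammaInvariant hH L)
    (hshift : IsBoundedShift hH L) : ∃ D : HilbertSystem hH, D.Factors L ∧ D.IsMinimal := by
  choose E V hV hd using fun s => (hpos s).exists_factor
  let W : ∀ {s t : S} (α : G.Fib s t) (x : A.Block s), H x.1 →L[𝕜] E t := fun α x =>
    (V _ (A.smul α x)).comp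
      (HilbertSp.ident (hH α x).symm).toContinuousLinearEquiv.toContinuousLinearMap
  have hW : ∀ {s t : S} (α : G.Fib s t) (x : A.Block s) (h : H x.1),
      W α x h = V t (A.smul α x) (HilbertSp.ident (hH α x).symm h) := fun α x h => rfl
  have hbound : ∀ {s t : S} (α : G.Fib s t), ∃ C, ∀ f,
      ‖synthesis (W α) f‖ ≤ C * ‖synthesis (V s) f‖ := by
    intro s t α
    obtain ⟨M, hM, hle⟩ := hshift α
    refine ⟨√M, fun f => abs_le_of_sq_le_sq' ?_ (by positivity) |>.2⟩
    rw [mul_pow, Real.sq_sqrt hM, ← OpKernel.form_self_eq_norm_sq (V s) (hV s),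
      ← OpKernel.form_self_eq_norm_sq (K := L.shift hH α) (W α)]
    · exact hle f
    · intro x y h k
      rw [hW, hW, ← hV t]
      exact HilbertSp.inner_ident _ _ _
  let T : ∀ {s t : S}, G.Fib s t → (E s →L[𝕜] E t) := fun {s t} α =>
    (synthesis (W α)).extendOfNorm (synthesis (V s))
  have hT : ∀ {s t : S} (α : G.Fib s t) (x : A.Block s) (h : H x.1),
      T α (V s x h) = V t (A.smul α x) (HilbertSp.ident (hH α x).symm h) := by
    classical
    intro s t α x h
    have := LinearMap.extendOfNorm_eq (f := synthesis (W α)) (hd s) (hbound α)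
      (DFinsupp.single x h)
    rwa [synthesis_single, synthesis_single] at this
  have hadj : ∀ {s t : S} (α : G.Fib s t), ContinuousLinearMap.adjoint (T α) = T α.star := by
    intro s t α
    refine clm_ext_of_dense (hd t) fun y k => eq_of_inner_eq (hd s) fun x h => ?_
    rw [ContinuousLinearMap.adjoint_inner_right, hT, hT, ← hV t, ← hV s]
    exact hinv.inner_eq α x y h k
  refine ⟨⟨E, fun {s} => V s, T, fun {r s t} α β u => ?_, fun {s t} α u v => ?_, hT⟩, hV, hd⟩
  · refine DFunLike.congr_fun (f := T (α.mul β)) (g := (T α).comp (T β))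
      (clm_ext_of_dense (hd r) fun x h => ?_) u
    rw [ContinuousLinearMap.comp_apply, hT, hT, hT, HilbertSp.ident_ident,
      apply_eq_of_eq (V := V t) (LeftAction.mul_smul α β x), HilbertSp.ident_ident]
  · rw [← hadj, ContinuousLinearMap.adjoint_inner_right]

end Systems

/-! ### Square roots by iteration, uniformly over the real and complex fields. -/

section Sqrt

variable (𝕜 : Type w) [RCLike 𝕜]

/-- The iteration `Y ↦ (B + Y²) / 2`, whose limit `Y` satisfies `(1 - Y)² = 1 - B`. -/
noncomputable def sqrtIter {R : Type*} [Ring R] [Algebra 𝕜 R] (B : R) : ℕ → R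
  | 0 => 0
  | n + 1 => (2⁻¹ : 𝕜) • (B + sqrtIter B n * sqrtIter B n)

/-- The scalar iteration at `B = 1` is the majorant of all the others; its increments are `(1 - y)²
/ 2`. -/
theorem sqrtIter_one_bounds (n : ℕ) :
    0 ≤ sqrtIter ℝ (1 : ℝ) n ∧ sqrtIter ℝ (1 : ℝ) n ≤ 1 ∧
      sqrtIter ℝ (1 : ℝ) n ≤ sqrtIter ℝ (1 : ℝ) (n + 1) := by
  have key : ∀ n, 0 ≤ sqrtIter ℝ (1 : ℝ) n ∧ sqrtIter ℝ (1 : ℝ) n ≤ 1 := by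
    intro n
    induction n with
    | zero => simp [sqrtIter]
    | succ n ih => simp only [sqrtIter, smul_eq_mul]; constructor <;> nlinarith
  refine ⟨(key n).1, (key n).2, ?_⟩
  simp only [sqrtIter, smul_eq_mul]
  nlinarith [sq_nonneg (1 - sqrtIter ℝ (1 : ℝ) n)]

variable {R : Type*} [NormedRing R] [NormedAlgebra 𝕜 R] {B : R}

theorem norm_sqrtIter_le (hB : ‖B‖ ≤ 1) (n : ℕ) : ‖sqrtIter 𝕜 B n‖ ≤ sqrtIter ℝ (1 : ℝ) n := by
  induction n with
  | zero => simp [sqrtIter]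
  | succ n ih =>
    simp only [sqrtIter, norm_smul, smul_eq_mul]
    rw [norm_inv, RCLike.norm_ofNat]
    have h0 := (sqrtIter_one_bounds n).1
    gcongr
    refine (norm_add_le _ _).trans (add_le_add hB ((norm_mul_le _ _).trans ?_))
    gcongr

/-- The recursion has nonnegative coefficients, so increments are majorised by the scalar ones,
which telescope to at most `1`. No rate of convergence is needed, hence `‖B‖ = 1` is allowed. -/
theorem norm_sqrtIter_sub_le (hB : ‖B‖ ≤ 1) (n : ℕ) :
    ‖sqrtIter 𝕜 B (n + 1) - sqrtIter 𝕜 B n‖ ≤ sqrtIter ℝ (1 : ℝ) (n + 1) - sqrtIter ℝ (1 : ℝ) n := by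
  induction n with
  | zero =>
    simpa [sqrtIter, norm_smul] using hB
  | succ n ih =>
    set a := sqrtIter 𝕜 B (n + 1)
    set b := sqrtIter 𝕜 B n
    set x := sqrtIter ℝ (1 : ℝ) (n + 1)
    set y := sqrtIter ℝ (1 : ℝ) n
    have ha : ‖a‖ ≤ x := norm_sqrtIter_le 𝕜 hB _
    have hb : ‖b‖ ≤ y := norm_sqrtIter_le 𝕜 hB _
    -- `a² - b²` is written in symmetrised form, which holds without commutativity.
    have e1 : sqrtIter 𝕜 B (n + 1 + 1) - a =
        (4⁻¹ : 𝕜) • ((a - b) * (a + b) + (a + b) * (a - b)) := by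
      have h1 : (a - b) * (a + b) + (a + b) * (a - b) = (2 : 𝕜) • (a * a - b * b) := by
        rw [two_smul]; noncomm_ring
      have h2 : a = (2⁻¹ : 𝕜) • (B + b * b) := rfl
      have h3 : sqrtIter 𝕜 B (n + 1 + 1) = (2⁻¹ : 𝕜) • (B + a * a) := rfl
      have h4 : (2⁻¹ : 𝕜) • (B + a * a) - (2⁻¹ : 𝕜) • (B + b * b) =
          (2⁻¹ : 𝕜) • (a * a - b * b) := by rw [← smul_sub]; congr 1; abel
      rw [← h2, ← h3] at h4
      rw [h1, smul_smul, h4]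
      norm_num
    have e2 : sqrtIter ℝ (1 : ℝ) (n + 1 + 1) - x = 4⁻¹ * ((x - y) * (x + y) + (x + y) * (x - y)) := by
      have h2 : x = 2⁻¹ * (1 + y * y) := rfl
      have h3 : sqrtIter ℝ (1 : ℝ) (n + 1 + 1) = 2⁻¹ * (1 + x * x) := rfl
      rw [h3]
      nlinarith
    have hab : ‖a + b‖ ≤ x + y := (norm_add_le _ _).trans (add_le_add ha hb)
    have hxy : 0 ≤ x - y := (norm_nonneg _).trans ih
    have hxy' : 0 ≤ x + y := (norm_nonneg _).trans hab
    rw [e1, e2, norm_smul, norm_inv, RCLike.norm_ofNat]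
    gcongr
    refine (norm_add_le _ _).trans (add_le_add ?_ ?_)
    · exact (norm_mul_le _ _).trans (mul_le_mul ih hab (norm_nonneg _) hxy)
    · exact (norm_mul_le _ _).trans (mul_le_mul hab ih (norm_nonneg _) hxy')

theorem cauchySeq_sqrtIter (hB : ‖B‖ ≤ 1) : CauchySeq (sqrtIter 𝕜 B) := by
  refine cauchySeq_of_summable_dist ?_
  refine Summable.of_nonneg_of_le (fun _ => dist_nonneg)
    (g := fun n => dist (sqrtIter 𝕜 B n) (sqrtIter 𝕜 B (n + 1)))
    (f := fun n => sqrtIter ℝ (1 : ℝ) (n + 1) - sqrtIter ℝ (1 : ℝ) n)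
    (fun n => by rw [dist_comm, dist_eq_norm]; exact norm_sqrtIter_sub_le 𝕜 hB n) ?_
  refine summable_of_sum_range_le (c := 1)
    (fun n => sub_nonneg.2 (sqrtIter_one_bounds n).2.2) fun n => ?_
  rw [Finset.sum_range_sub]
  have := (sqrtIter_one_bounds n).2.1
  simpa [sqrtIter] using this

/-- The limit of `sqrtIter 𝕜 B`. -/
noncomputable def sqrtLim (B : R) : R := @Filter.limUnder R _ _ ⟨0⟩ Filter.atTop (sqrtIter 𝕜 B)

variable [CompleteSpace R]

theorem tendsto_sqrtIter (hB : ‖B‖ ≤ 1) :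
    Filter.Tendsto (sqrtIter 𝕜 B) Filter.atTop (nhds (sqrtLim 𝕜 B)) :=
  tendsto_nhds_limUnder (cauchySeq_tendsto_of_complete (cauchySeq_sqrtIter 𝕜 hB))

theorem norm_sqrtLim_le (hB : ‖B‖ ≤ 1) : ‖sqrtLim 𝕜 B‖ ≤ 1 :=
  le_of_tendsto (tendsto_sqrtIter 𝕜 hB).norm
    (Filter.Eventually.of_forall fun n => (norm_sqrtIter_le 𝕜 hB n).trans (sqrtIter_one_bounds n).2.1)

theorem one_sub_sqrtLim_sq (hB : ‖B‖ ≤ 1) : (1 - sqrtLim 𝕜 B) * (1 - sqrtLim 𝕜 B) = 1 - B := by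
  have h1 := tendsto_sqrtIter 𝕜 hB
  have h2 := (h1.comp (Filter.tendsto_add_atTop_nat 1))
  have h3 : Filter.Tendsto (fun n => (2⁻¹ : 𝕜) • (B + sqrtIter 𝕜 B n * sqrtIter 𝕜 B n)) Filter.atTop
      (nhds ((2⁻¹ : 𝕜) • (B + sqrtLim 𝕜 B * sqrtLim 𝕜 B))) :=
    ((h1.mul h1).const_add B).const_smul _
  have h4 := tendsto_nhds_unique h2 h3
  have h5 : (2 : 𝕜) • sqrtLim 𝕜 B = B + sqrtLim 𝕜 B * sqrtLim 𝕜 B := by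
    conv_lhs => rw [h4]
    rw [smul_smul]; norm_num
  have h6 : sqrtLim 𝕜 B * sqrtLim 𝕜 B = (2 : 𝕜) • sqrtLim 𝕜 B - B := by rw [h5]; abel
  rw [two_smul] at h6
  calc _ = 1 - sqrtLim 𝕜 B - sqrtLim 𝕜 B + sqrtLim 𝕜 B * sqrtLim 𝕜 B := by noncomm_ring
    _ = _ := by rw [h6]; abel

end Sqrt

/-! ### Symmetric contractions: the root of the absolute value and the positive projection. -/

section Operators

variable {𝕜 : Type w} [RCLike 𝕜] {E F : Type*} [NormedAddCommGroup E] [InnerProductSpace 𝕜 E]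
  [CompleteSpace E] [NormedAddCommGroup F] [InnerProductSpace 𝕜 F] [CompleteSpace F]

theorem tendsto_sqrtIter_apply {B : E →L[𝕜] E} (hB : ‖B‖ ≤ 1) (u : E) :
    Filter.Tendsto (fun n => sqrtIter 𝕜 B n u) Filter.atTop (nhds (sqrtLim 𝕜 B u)) :=
  ((ContinuousLinearMap.apply 𝕜 E u).continuous.tendsto _).comp (tendsto_sqrtIter 𝕜 hB)

/-- Every iterate is a polynomial in the operator, so intertwining holds for iterates and passes to
the limit. -/
theorem map_sqrtLim {B : E →L[𝕜] E} {C : F →L[𝕜] F} (hB : ‖B‖ ≤ 1) (hC : ‖C‖ ≤ 1)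
    (T : E →L[𝕜] F) (hT : ∀ u, T (B u) = C (T u)) (u : E) :
    T (sqrtLim 𝕜 B u) = sqrtLim 𝕜 C (T u) := by
  have key : ∀ n u, T (sqrtIter 𝕜 B n u) = sqrtIter 𝕜 C n (T u) := by
    intro n
    induction n with
    | zero => simp [sqrtIter]
    | succ n ih => intro u; simp [sqrtIter, hT, ih]
  refine tendsto_nhds_unique
    ((T.continuous.tendsto _).comp (tendsto_sqrtIter_apply hB u)) ?_
  simpa [Function.comp_def, key] using tendsto_sqrtIter_apply hC (T u)

theorem inner_sqrtLim {B : E →L[𝕜] E} (hB : ‖B‖ ≤ 1)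
    (hs : ∀ u v, inner 𝕜 (B u) v = inner 𝕜 u (B v)) (u v : E) :
    inner 𝕜 (sqrtLim 𝕜 B u) v = inner 𝕜 u (sqrtLim 𝕜 B v) := by
  have key : ∀ n u v, inner 𝕜 (sqrtIter 𝕜 B n u) v = inner 𝕜 u (sqrtIter 𝕜 B n v) := by
    intro n
    induction n with
    | zero => simp [sqrtIter]
    | succ n ih =>
      intro u v
      simp [sqrtIter, hs, ih, inner_add_left, inner_add_right, inner_smul_left, inner_smul_right,
        map_ofNat (starRingEnd 𝕜) 2]
  refine tendsto_nhds_unique ((tendsto_sqrtIter_apply hB u).inner tendsto_const_nhds) ?_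
  simpa [key] using (tendsto_const_nhds (x := u)).inner (tendsto_sqrtIter_apply hB v)

/-- A symmetric operator of norm at most one. -/
structure IsSymmContraction (T : E →L[𝕜] E) : Prop where
  symm : ∀ u v, inner 𝕜 (T u) v = inner 𝕜 u (T v)
  norm_le : ‖T‖ ≤ 1

theorem IsSymmContraction.sqrtLim {B : E →L[𝕜] E} (hB : IsSymmContraction B) :
    IsSymmContraction (sqrtLim 𝕜 B) :=
  ⟨inner_sqrtLim hB.norm_le hB.symm, norm_sqrtLim_le 𝕜 hB.norm_le⟩

omit [CompleteSpace E] in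
-- `‖u - T²u‖² = ‖u‖² - 2‖Tu‖² + ‖T²u‖²`, and `‖T²u‖ ≤ ‖Tu‖`.
theorem IsSymmContraction.one_sub_sq {T : E →L[𝕜] E} (hT : IsSymmContraction T) :
    IsSymmContraction (1 - T * T) where
  symm u v := by simp [inner_sub_left, inner_sub_right, hT.symm]
  norm_le := by
    refine ContinuousLinearMap.opNorm_le_bound _ zero_le_one fun u => ?_
    rw [one_mul]
    refine abs_le_of_sq_le_sq' ?_ (norm_nonneg _) |>.2
    have h1 : ‖T (T u)‖ ^ 2 ≤ ‖T u‖ ^ 2 := by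
      gcongr
      simpa using T.le_of_opNorm_le hT.norm_le (T u)
    have h2 : (1 - T * T) u = u - T (T u) := by simp
    have h3 : RCLike.re (inner 𝕜 u (T (T u))) = ‖T u‖ ^ 2 := by
      rw [← hT.symm, inner_self_eq_norm_sq]
    rw [h2, norm_sub_sq (𝕜 := 𝕜), h3]
    nlinarith [sq_nonneg ‖T u‖]

/-- A square root of `√(T²)` for a symmetric contraction `T`. -/
noncomputable def absSqrt (T : E →L[𝕜] E) : E →L[𝕜] E :=
  1 - sqrtLim 𝕜 (sqrtLim 𝕜 (1 - T * T))

/-- The orthogonal projection on the subspace where `T` agrees with its absolute value. -/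
noncomputable def posProj (T : E →L[𝕜] E) : E →L[𝕜] E :=
  (absSqrt T * absSqrt T - T).ker.starProjection

theorem posProj_idem (T : E →L[𝕜] E) (u : E) : posProj T (posProj T u) = posProj T u :=
  Submodule.starProjection_eq_self_iff.2 (Submodule.starProjection_apply_mem _ _)

theorem inner_posProj (T : E →L[𝕜] E) (u v : E) :
    inner 𝕜 (posProj T u) v = inner 𝕜 u (posProj T v) :=
  Submodule.inner_starProjection_left_eq_right _ u v

theorem posProj_eq_self {T : E →L[𝕜] E} {u : E} (hu : absSqrt T (absSqrt T u) = T u) :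
    posProj T u = u :=
  Submodule.starProjection_eq_self_iff.2 (by simp [LinearMap.mem_ker, hu])

theorem absSqrt_sq_posProj (T : E →L[𝕜] E) (u : E) :
    absSqrt T (absSqrt T (posProj T u)) = T (posProj T u) := by
  have : posProj T u ∈ (absSqrt T * absSqrt T - T).ker := Submodule.starProjection_apply_mem _ _
  simpa [LinearMap.mem_ker, sub_eq_zero] using this

namespace IsSymmContraction

variable {T : E →L[𝕜] E} (hT : IsSymmContraction T) {T' : F →L[𝕜] F} (hT' : IsSymmContraction T')

include hT

theorem absSqrt_symm (u v : E) : inner 𝕜 (absSqrt T u) v = inner 𝕜 u (absSqrt T v) := by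
  simp [absSqrt, inner_sub_left, inner_sub_right, hT.one_sub_sq.sqrtLim.sqrtLim.symm]

/-- Two applications of `(1 - Y)² = 1 - B`. Positivity of `absSqrt T` is never needed: being
symmetric, it has a positive square. -/
theorem absSqrt_pow_four (u : E) :
    absSqrt T (absSqrt T (absSqrt T (absSqrt T u))) = T (T u) := by
  have h1 := one_sub_sqrtLim_sq 𝕜 hT.one_sub_sq.sqrtLim.norm_le
  have h2 := one_sub_sqrtLim_sq 𝕜 hT.one_sub_sq.norm_le
  have h3 : absSqrt T * absSqrt T * (absSqrt T * absSqrt T) = T * T := by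
    rw [absSqrt, h1, h2]; abel
  exact DFunLike.congr_fun h3 u

include hT' in
theorem map_absSqrt (C : E →L[𝕜] F) (hC : ∀ u, C (T u) = T' (C u)) (u : E) :
    C (absSqrt T u) = absSqrt T' (C u) := by
  have h1 := map_sqrtLim hT.one_sub_sq.norm_le hT'.one_sub_sq.norm_le C (by simp [hC])
  have h2 := map_sqrtLim hT.one_sub_sq.sqrtLim.norm_le hT'.one_sub_sq.sqrtLim.norm_le C h1
  simp [absSqrt, h2]

theorem absSqrt_comm (u : E) : T (absSqrt T u) = absSqrt T (T u) :=
  hT.map_absSqrt hT T (fun _ => rfl) u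

include hT' in
-- `C` maps `ker (|T| - T)` into `ker (|T'| - T')`, and its adjoint `C'` maps back, since it
-- intertwines in the other direction. Thus `C P = P' C P`, and the adjoint of `C' P' = P C' P'`
-- gives `P' C = P' C P`.
theorem map_posProj (C : E →L[𝕜] F) (C' : F →L[𝕜] E)
    (hCC' : ∀ u v, inner 𝕜 (C u) v = inner 𝕜 u (C' v)) (hC : ∀ u, C (T u) = T' (C u)) (u : E) :
    C (posProj T u) = posProj T' (C u) := by
  have hC' : ∀ v, C' (T' v) = T (C' v) := fun v => by
    refine ext_inner_left 𝕜 fun u => ?_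
    rw [← hCC', ← hT'.symm, ← hC, hCC', hT.symm]
  have h1 : ∀ u, posProj T' (C (posProj T u)) = C (posProj T u) := fun u =>
    posProj_eq_self (by
      rw [← hT.map_absSqrt hT' C hC, ← hT.map_absSqrt hT' C hC, absSqrt_sq_posProj, hC])
  have h2 : ∀ v, posProj T (C' (posProj T' v)) = C' (posProj T' v) := fun v =>
    posProj_eq_self (by
      rw [← hT'.map_absSqrt hT C' hC', ← hT'.map_absSqrt hT C' hC', absSqrt_sq_posProj, hC'])
  rw [← h1]
  refine ext_inner_right 𝕜 fun v => ?_
  rw [inner_posProj, hCC', inner_posProj, h2, ← hCC', inner_posProj]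

theorem posProj_absSqrt (u : E) : absSqrt T (posProj T u) = posProj T (absSqrt T u) :=
  hT.map_posProj hT _ _ hT.absSqrt_symm (fun u => (hT.absSqrt_comm u).symm) u

/-- `T = Z (2 P - 1) Z` for `Z = absSqrt T` and `P = posProj T`. -/
theorem eq_absSqrt_posProj (u : E) :
    T u = absSqrt T ((2 : 𝕜) • posProj T (absSqrt T u) - absSqrt T u) := by
  -- `(Z² - T)(Z² + T) = Z⁴ - T² = 0`, so `(Z² + T) u` lies in the range of `P`.
  have h1 : posProj T (absSqrt T (absSqrt T u) + T u) = absSqrt T (absSqrt T u) + T u := by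
    refine posProj_eq_self ?_
    rw [map_add, map_add, map_add, hT.absSqrt_pow_four, ← hT.absSqrt_comm, ← hT.absSqrt_comm,
      add_comm]
  -- The range of the symmetric operator `Z² - T` is orthogonal to its kernel. Together with `h1`
  -- this gives `2 P Z² = Z² + T`.
  have h2 : posProj T (absSqrt T (absSqrt T u) - T u) = 0 := by
    refine ext_inner_right 𝕜 fun v => ?_
    rw [inner_posProj, inner_sub_left, hT.absSqrt_symm, hT.absSqrt_symm, hT.symm,
      absSqrt_sq_posProj, sub_self, inner_zero_left]
  rw [map_add] at h1
  rw [map_sub, sub_eq_zero] at h2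
  rw [map_sub, map_smul, hT.posProj_absSqrt, two_smul]
  nth_rw 2 [h2]
  rw [h1]
  abel

end IsSymmContraction

end Operators

/-! ### Polar decomposition of the kernel and disjoint positive and negative parts. -/

section Polar

variable {𝕜 : Type w} [RCLike 𝕜] {Γ : Type uΓ} {S : Type uS} {G : StarSemigroupoid Γ S}
  {X : Type u} {A : LeftAction G X} {H : X → HilbertSp.{v} 𝕜}

namespace HilbertSystem

variable {hH : ConstantOnOrbits A H} (D : HilbertSystem hH)

/-- The kernel `V_x^* V_y`. -/
noncomputable def kernel : OpKernel H :=
  OpKernel.ofBlocks A fun _ x y => (ContinuousLinearMap.adjoint (D.V x)).comp (D.V y)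

theorem factors_kernel : D.Factors D.kernel := fun s x y h k => by
  rw [kernel, OpKernel.ofBlocks_apply, ContinuousLinearMap.comp_apply,
    ContinuousLinearMap.adjoint_inner_right]

end HilbertSystem

/-- A minimal Hilbert system together with commuting symmetric operators `Z` and `P`, `P` a
projection, that commute with the representation and satisfy `K(x, y) = V_x^* Z (2 P - 1) Z V_y`. -/
structure PolarSystem (hH : ConstantOnOrbits A H) (K : OpKernel H) extends
    HilbertSystem hH where
  isMinimal : toHilbertSystem.IsMinimal
  Z : ∀ s, space s →L[𝕜] space s
  P : ∀ s, space s →L[𝕜] space s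
  Z_symm : ∀ s u v, inner 𝕜 (Z s u) v = inner 𝕜 u (Z s v)
  P_symm : ∀ s u v, inner 𝕜 (P s u) v = inner 𝕜 u (P s v)
  P_idem : ∀ s u, P s (P s u) = P s u
  Z_P : ∀ s u, Z s (P s u) = P s (Z s u)
  op_Z : ∀ {s t : S} (α : G.Fib s t) (u : space s), op α (Z s u) = Z t (op α u)
  op_P : ∀ {s t : S} (α : G.Fib s t) (u : space s), op α (P s u) = P t (op α u)
  factor : ∀ (s : S) (x y : A.Block s) (h : H x.1) (k : H y.1),
    inner 𝕜 h (K x.1 y.1 k) =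
      inner 𝕜 (Z s (V x h)) ((2 : 𝕜) • P s (Z s (V y k)) - Z s (V y k))

/-- The bound makes `K` a symmetric contraction `T` on the Kolmogorov spaces of `L`, and invariance
of `K` makes `T` commute with the representation. Naturality of `absSqrt` and `posProj` under
intertwiners does the rest. -/
theorem exists_polarSystem {hH : ConstantOnOrbits A H} {K L : OpKernel H}
    (hK : IsPartiallyHermitian A K) (hKinv : IsGammaInvariant hH K)
    (hpos : IsPartiallyPosSemidef A L) (hinv : IsGammaInvariant hH L)
    (hshift : IsBoundedShift hH L)
    (hle : ∀ (s : S) (f g : FinSection (fun x : A.Block s => H x.1)),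
      ‖(K.block A s).form f g‖ ≤
        √(RCLike.re ((L.block A s).form f f)) * √(RCLike.re ((L.block A s).form g g))) :
    Nonempty (PolarSystem hH K) := by
  obtain ⟨D, hD, hmin⟩ := exists_hilbertSystem hpos hinv hshift
  have hsqrt : ∀ s f, √(RCLike.re ((L.block A s).form f f)) =
      ‖synthesis (fun x : A.Block s => D.V x) f‖ := fun s f => by
    rw [OpKernel.form_self_eq_norm_sq (K := L.block A s) (fun x : A.Block s => D.V x) (hD s),
      Real.sqrt_sq (norm_nonneg _)]
  simp only [hsqrt] at hle
  choose T hT1 hT using fun s => OpKernel.exists_contraction (hmin s) (hle s)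
  have hsymm : ∀ s, IsSymmContraction (T s) := fun s => by
    refine ⟨fun u v => ?_, hT1 s⟩
    have : ContinuousLinearMap.adjoint (T s) = T s := by
      refine clm_ext_of_dense (hmin s) fun y k => eq_of_inner_eq (hmin s) fun x h => ?_
      rw [ContinuousLinearMap.adjoint_inner_right, hT, ← inner_conj_symm, hT, inner_conj_symm]
      exact ((hK s).inner_eq x y h k).symm
    rw [← ContinuousLinearMap.adjoint_inner_right, this]
  have hop : ∀ {s t : S} (α : G.Fib s t) (u : D.space s), D.op α (T s u) = T t (D.op α u) := by
    intro s t α u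
    refine DFunLike.congr_fun (f := (D.op α).comp (T s)) (g := (T t).comp (D.op α))
      (clm_ext_of_dense (hmin s) fun x h => eq_of_inner_eq (hmin t) fun y k => ?_) u
    simp only [ContinuousLinearMap.comp_apply]
    rw [← HilbertSystem.op_star_left, D.op_V, D.op_V, hT, hT]
    refine ((hK s).inner_eq _ _ _ _).trans ?_
    refine Eq.trans ?_ ((hK t).inner_eq _ _ _ _).symm
    have := congrArg conj (hKinv.inner_eq α x y h k)
    rw [inner_conj_symm, inner_conj_symm] at this
    exact this.symm
  refine ⟨⟨D, hmin, fun s => absSqrt (T s), fun s => posProj (T s), fun s => (hsymm s).absSqrt_symm,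
    fun s => inner_posProj _, fun s => posProj_idem _, fun s => (hsymm s).posProj_absSqrt,
    fun {s t} α => (hsymm s).map_absSqrt (hsymm t) _ (hop α),
    fun {s t} α => (hsymm s).map_posProj (hsymm t) _ _ (D.op_star α) (hop α),
    fun s x y h k => ?_⟩⟩
  rw [(hsymm s).absSqrt_symm, ← (hsymm s).eq_absSqrt_posProj, hT]
  rfl

namespace PolarSystem

variable {hH : ConstantOnOrbits A H} {K : OpKernel H} (D : PolarSystem hH K)

/-- The Hilbert system of the positive part of the kernel. -/
noncomputable def posPart : HilbertSystem hH :=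
  D.compress (fun s => (D.P s).comp (D.Z s)) fun α u => by simp [D.op_Z, D.op_P]

/-- The Hilbert system of the negative part of the kernel. -/
noncomputable def negPart : HilbertSystem hH :=
  D.compress (fun s => D.Z s - (D.P s).comp (D.Z s)) fun α u => by simp [D.op_Z, D.op_P]

/-- The negative kernel is taken as a difference with `K`, not as `D.negPart.kernel`, because the
decomposition must also hold off the blocks, where `K` is arbitrary and `kernel` is zero. -/
theorem factors_negPart : D.negPart.Factors (D.posPart.kernel - K) := by
  intro s x y h k
  have h1 : inner 𝕜 h (D.posPart.kernel x.1 y.1 k) =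
      inner 𝕜 (D.P s (D.Z s (D.V x h))) (D.P s (D.Z s (D.V y k))) :=
    D.posPart.factors_kernel s x y h k
  have h2 := D.factor s x y h k
  change inner 𝕜 h (D.posPart.kernel x.1 y.1 k - K x.1 y.1 k) =
    inner 𝕜 (D.Z s (D.V x h) - D.P s (D.Z s (D.V x h)))
      (D.Z s (D.V y k) - D.P s (D.Z s (D.V y k)))
  simp only [inner_sub_left, inner_sub_right, D.P_symm, D.P_idem, inner_smul_right] at *
  rw [h1, h2]
  ring

/-- A kernel below both parts has a Kolmogorov synthesis map of the form `C ∘ synthesis V`, where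
`‖C v‖` is at most `‖P Z v‖` and at most `‖(1 - P) Z v‖`. As `Z` and `P` commute, `C` kills the
ranges of `1 - P` and of `P`. -/
theorem areDisjoint : AreDisjoint A D.posPart.kernel (D.posPart.kernel - K) := by
  classical
  intro L hL h1 h2 s
  obtain ⟨F, U, hU, -⟩ := (hL s).exists_factor
  let V := fun x : A.Block s => D.V x
  have bound : ∀ (C : D.space s →L[𝕜] D.space s) (M : OpKernel H), PartialLE A L M →
      (∀ (x y : A.Block s) (h : H x.1) (k : H y.1),
        inner 𝕜 h (M x.1 y.1 k) = inner 𝕜 (C.comp (V x) h) (C.comp (V y) k)) →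
      ∀ f, ‖synthesis U f‖ ≤ ‖C (synthesis V f)‖ := by
    intro C M hM hC f
    refine abs_le_of_sq_le_sq' ?_ (norm_nonneg _) |>.2
    rw [← OpKernel.form_self_eq_norm_sq U hU, ← synthesis_comp,
      ← OpKernel.form_self_eq_norm_sq (K := M.block A s) (fun x => C.comp (V x)) hC]
    have h3 : 0 ≤ RCLike.re ((M.block A s - L.block A s).form f f) := (hM s).nonneg f
    rw [OpKernel.form_sub, map_sub] at h3
    linarith
  have b1 := bound ((D.P s).comp (D.Z s)) _ h1 (D.posPart.factors_kernel s)
  have b2 := bound (D.Z s - (D.P s).comp (D.Z s)) _ h2 (D.factors_negPart s)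
  have b3 : ∀ f, ‖synthesis U f‖ ≤ ‖(D.P s).comp (D.Z s)‖ * ‖synthesis V f‖ := fun f =>
    (b1 f).trans (ContinuousLinearMap.le_opNorm _ _)
  let C := (synthesis U).extendOfNorm (synthesis V)
  have hC : ∀ f, C (synthesis V f) = synthesis U f := fun f =>
    LinearMap.extendOfNorm_eq (D.isMinimal s) ⟨_, b3⟩ f
  have c1 : ∀ v, ‖C v‖ ≤ ‖(D.P s).comp (D.Z s) v‖ := fun v =>
    (D.isMinimal s).induction_on v (isClosed_le (by fun_prop) (by fun_prop)) fun f => by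
      change ‖C (synthesis V f)‖ ≤ _
      rw [hC]; exact b1 f
  have c2 : ∀ v, ‖C v‖ ≤ ‖(D.Z s - (D.P s).comp (D.Z s)) v‖ := fun v =>
    (D.isMinimal s).induction_on v (isClosed_le (by fun_prop) (by fun_prop)) fun f => by
      change ‖C (synthesis V f)‖ ≤ _
      rw [hC]; exact b2 f
  have hC0 : ∀ v, C v = 0 := by
    intro v
    have e1 : C (D.P s v) = 0 := by
      have := c2 (D.P s v)
      simpa [D.Z_P, D.P_idem] using this
    have e2 : C (v - D.P s v) = 0 := by
      have := c1 (v - D.P s v)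
      simpa [D.Z_P, D.P_idem] using this
    rwa [map_sub, e1, sub_zero] at e2
  have hU0 : ∀ x h, U x h = 0 := fun x h => by
    rw [← synthesis_single U, ← hC, hC0]
  funext x y
  ext k
  refine ext_inner_left 𝕜 fun h => ?_
  rw [hU, hU0]
  simp

include D in
theorem exists_disjoint_decomposition : ∃ K₁ K₂ : OpKernel H, K = K₁ - K₂ ∧
    (IsPartiallyPosSemidef A K₁ ∧ IsGammaInvariant hH K₁ ∧ IsBoundedShift hH K₁) ∧
    (IsPartiallyPosSemidef A K₂ ∧ IsGammaInvariant hH K₂ ∧ IsBoundedShift hH K₂) ∧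
    AreDisjoint A K₁ K₂ :=
  have h1 := D.posPart.factors_kernel
  have h2 := D.factors_negPart
  ⟨_, _, (sub_sub_cancel _ _).symm,
    ⟨h1.isPartiallyPosSemidef, h1.isGammaInvariant, h1.isBoundedShift⟩,
    ⟨h2.isPartiallyPosSemidef, h2.isGammaInvariant, h2.isBoundedShift⟩, D.areDisjoint⟩

end PolarSystem

end Polar

/-! ### Passing between Krein spaces and Hilbert spaces with a symmetry. -/

section Transport

variable {𝕜 : Type w} [RCLike 𝕜] {E : Type*} [NormedAddCommGroup E] [InnerProductSpace 𝕜 E]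

section

variable {M : Type*} [AddCommGroup M] [Module 𝕜 M] {B : M →ₗ[𝕜] M →ₗ⋆[𝕜] 𝕜}

/-- A linear equivalence with a Hilbert space that is compatible with the inner products is an
isometry. -/
theorem IsPosDefInner.norm_map (hB : IsPosDefInner B) (e : M ≃ₗ[𝕜] E)
    (he : ∀ x y, B x y = inner 𝕜 (e y) (e x)) (x : M) : ‖e x‖ = hB.normed.norm x := by
  let := hB.normed
  let := hB.innerSpace
  rw [@norm_eq_sqrt_re_inner 𝕜 E, ← he]
  exact (@norm_eq_sqrt_re_inner 𝕜 M _ _ _ x).symm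

theorem isFundamentalSymmetry_of_equiv [CompleteSpace E] {J : M →ₗ[𝕜] M}
    (hJ : ∀ x, J (J x) = x) (e : M ≃ₗ[𝕜] E) (he : ∀ x y, B (J x) y = inner 𝕜 (e y) (e x)) :
    IsFundamentalSymmetry B J := by
  have hpos : IsPosDefInner (B.comp J) :=
    { conj_symm := fun x y => by simp [he]
      pos := fun x hx => by
        rw [LinearMap.comp_apply, he, inner_self_eq_norm_sq]
        have : e x ≠ 0 := by simpa using hx
        positivity }
  refine ⟨hJ, hpos, ?_⟩
  let := hpos.normed
  let := hpos.innerSpace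
  let e' : M ≃ₗᵢ[𝕜] E := { e with norm_map' := hpos.norm_map e he }
  exact (completeSpace_congr (e := e'.toEquiv) e'.isometry.isUniformEmbedding).2 inferInstance

end

theorem KreinSpace.continuous_equiv (K : KreinSpace.{v} 𝕜) {J : K →ₗ[𝕜] K}
    (h : IsFundamentalSymmetry K.form J) (e : K ≃ₗ[𝕜] E)
    (he : ∀ x y, K.form (J x) y = inner 𝕜 (e y) (e x)) :
    Continuous e ∧ Continuous e.symm := by
  rw [K.strongTopology_eq h]
  let := h.hilbert.posDef.normed
  let := h.hilbert.posDef.innerSpace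
  let e' : K ≃ₗᵢ[𝕜] E := { e with norm_map' := h.hilbert.posDef.norm_map e he }
  exact ⟨e'.continuous, e'.symm.continuous⟩

/-- A Krein space with a fundamental symmetry, as a Hilbert space. -/
noncomputable def KreinSpace.toHilbertSp (K : KreinSpace.{v} 𝕜) {J : K →ₗ[𝕜] K}
    (h : IsFundamentalSymmetry K.form J) : HilbertSp.{v} 𝕜 :=
  @HilbertSp.mk 𝕜 _ K.carrier h.hilbert.posDef.normed
    h.hilbert.posDef.innerSpace h.hilbert.complete

theorem KreinSpace.exists_equiv (K : KreinSpace.{v} 𝕜) {J : K →ₗ[𝕜] K}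
    (h : IsFundamentalSymmetry K.form J) :
    ∃ e : K ≃L[𝕜] K.toHilbertSp h, ∀ x y, K.form (J x) y = inner 𝕜 (e y) (e x) := by
  let e : K ≃ₗ[𝕜] K.toHilbertSp h := LinearEquiv.refl 𝕜 K.carrier
  have he : ∀ x y, K.form (J x) y = inner 𝕜 (e y) (e x) := fun x y => rfl
  have hc := K.continuous_equiv h e he
  exact ⟨⟨e, hc.1, hc.2⟩, he⟩

/-- Bounded operators of Hilbert spaces are bounded operators of the isomorphic Krein spaces. -/
theorem KreinSpace.exists_clm_of_equiv {F : Type*} [NormedAddCommGroup F] [InnerProductSpace 𝕜 F]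
    (K L : KreinSpace.{v} 𝕜) {J : K →ₗ[𝕜] K} {J' : L →ₗ[𝕜] L}
    (h : IsFundamentalSymmetry K.form J) (h' : IsFundamentalSymmetry L.form J')
    (e : K ≃ₗ[𝕜] E) (e' : L ≃ₗ[𝕜] F) (he : ∀ x y, K.form (J x) y = inner 𝕜 (e y) (e x))
    (he' : ∀ x y, L.form (J' x) y = inner 𝕜 (e' y) (e' x)) (T : E →L[𝕜] F) :
    ∃ T' : K →L[𝕜] L, ∀ x, e' (T' x) = T (e x) :=
  ⟨⟨e'.symm.toLinearMap.comp (T.toLinearMap.comp e.toLinearMap),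
    (L.continuous_equiv h' e' he').2.comp (T.continuous.comp (K.continuous_equiv h e he).1)⟩,
    fun _ => e'.apply_symm_apply _⟩

/-- Weakly continuous linear maps from a Hilbert space to a Krein space are bounded. -/
theorem KreinSpace.continuous_of_weak [CompleteSpace E] (K : KreinSpace.{v} 𝕜) (c : E →ₗ[𝕜] K)
    (hc : ∀ w, Continuous fun a => K.form w (c a)) : Continuous c := by
  obtain ⟨J, hJ⟩ := K.isKrein.exists_symmetry
  obtain ⟨e, he⟩ := K.exists_equiv hJ
  have h1 : Continuous (e.toLinearMap.comp c) := by
    refine LinearMap.continuous_of_seq_closed_graph _ fun u x z hu hv => ?_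
    refine ext_inner_right 𝕜 fun w => ?_
    obtain ⟨w, rfl⟩ := e.surjective w
    refine tendsto_nhds_unique (hv.inner tendsto_const_nhds) ?_
    have h2 := ((hc (J w)).tendsto x).comp hu
    simp only [he, Function.comp_def] at h2
    exact h2
  have h3 : ⇑c = e.symm ∘ e.toLinearMap.comp c := by ext; simp
  rw [h3]
  exact e.symm.continuous.comp h1

/-- A weakly continuous linear map from a Hilbert space to a Krein space, as a bounded operator. -/
noncomputable def KreinSpace.clmOfWeak [CompleteSpace E] (K : KreinSpace.{v} 𝕜) (c : E →ₗ[𝕜] K)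
    (hc : ∀ w, Continuous fun a => K.form w (c a)) : E →L[𝕜] K :=
  ⟨c, K.continuous_of_weak c hc⟩

/-- The reproducing kernel Krein space of a kernel `V_x^* J V_y`. -/
theorem exists_rkKreinSpace {Y : Type u} {H : Y → HilbertSp.{v} 𝕜} {K : OpKernel H}
    [CompleteSpace E] (V : ∀ y, H y →L[𝕜] E) (J : E →L[𝕜] E) (hJ : ∀ a, J (J a) = a)
    (hJs : ∀ a b, inner 𝕜 (J a) b = inner 𝕜 a (J b))
    (hV : ∀ a, (∀ y h, inner 𝕜 (V y h) a = 0) → a = 0)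
    (hK : ∀ x y h k, inner 𝕜 h (K x y k) = inner 𝕜 (V x h) (J (V y k))) :
    ∃ (R : RKKreinSpace K) (e : R.toKreinSpace ≃ₗ[𝕜] E),
      (∀ f g : R.toKreinSpace, R.toKreinSpace.form f g = inner 𝕜 (e g) (J (e f))) ∧
      ∀ x h, e (R.col x h) = V x h := by
  -- With the factor `J` in `V_y^* J a`, the vector `V_x h` becomes exactly the column `K_x h`;
  -- totality of the ranges makes the map injective.
  let Φ : E →ₗ[𝕜] (∀ y : Y, (H y : Type v)) :=
    LinearMap.pi fun y => ((ContinuousLinearMap.adjoint (V y)).comp J).toLinearMap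
  have hΦ : ∀ a y h, inner 𝕜 h (Φ a y) = inner 𝕜 (V y h) (J a) := fun a y h =>
    ContinuousLinearMap.adjoint_inner_right _ _ _
  have hinj : Function.Injective Φ := by
    rw [← LinearMap.ker_eq_bot, LinearMap.ker_eq_bot']
    intro a ha
    have : J a = 0 := hV _ fun y h => by rw [← hΦ, ha]; simp
    rw [← hJ a, this, map_zero]
  let e := (LinearEquiv.ofInjective Φ hinj).symm
  have he : ∀ a, (e.symm a).1 = Φ a := fun a => rfl
  have hcol : ∀ x h, K.column x h = Φ (V x h) := fun x h => by
    funext y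
    refine ext_inner_left 𝕜 fun k => ?_
    rw [hΦ]; exact hK y x k h
  let B : LinearMap.range Φ →ₗ[𝕜] LinearMap.range Φ →ₗ⋆[𝕜] 𝕜 :=
    LinearMap.mk₂'ₛₗ (RingHom.id 𝕜) (starRingEnd 𝕜) (fun f g => inner 𝕜 (e g) (J (e f)))
      (fun f f' g => by simp [inner_add_right]) (fun c f g => by simp [inner_smul_right])
      (fun f g g' => by simp [inner_add_left]) (fun c f g => by simp [inner_smul_left])
  have hB : ∀ f g, B f g = inner 𝕜 (e g) (J (e f)) := fun f g => rfl
  let J' : LinearMap.range Φ →ₗ[𝕜] LinearMap.range Φ :=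
    e.symm.toLinearMap.comp (J.toLinearMap.comp e.toLinearMap)
  have hJ' : ∀ f, e (J' f) = J (e f) := fun f => by simp [J']
  have hBJ : ∀ f g, B (J' f) g = inner 𝕜 (e g) (e f) := fun f g => by rw [hB, hJ', hJ]
  have hfund : IsFundamentalSymmetry B J' :=
    isFundamentalSymmetry_of_equiv (fun f => e.injective (by rw [hJ', hJ', hJ])) e hBJ
  let R : RKKreinSpace K :=
    { space := LinearMap.range Φ
      form := B
      isKrein := ⟨fun f g => by rw [hB, hB, inner_conj_symm, hJs], J', hfund⟩
      column_mem := fun x h => ⟨V x h, (hcol x h).symm⟩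
      reproducing := fun f x h => by
        have h1 : (⟨K.column x h, V x h, (hcol x h).symm⟩ : LinearMap.range Φ) =
          e.symm (V x h) := Subtype.ext (hcol x h)
        rw [hB, h1, LinearEquiv.apply_symm_apply, ← hΦ, ← he, LinearEquiv.symm_apply_apply] }
  refine ⟨R, e, hB, fun x h => ?_⟩
  rw [← LinearEquiv.eq_symm_apply]
  exact Subtype.ext (hcol x h)

end Transport

/-! ### Reproducing kernel Krein spaces from a Hilbert system with a symmetry. -/

section Models

variable {𝕜 : Type w} [RCLike 𝕜] {Γ : Type uΓ} {S : Type uS} {G : StarSemigroupoid Γ S}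
  {X : Type u} {A : LeftAction G X} {H : X → HilbertSp.{v} 𝕜} {hH : ConstantOnOrbits A H}
  {K : OpKernel H}

/-- A symmetric involution of a Hilbert system that commutes with the representation and
represents the kernel `K`. -/
structure HilbertSystem.IsSymmetryFor (D : HilbertSystem hH)
    (J : ∀ s, D.space s →L[𝕜] D.space s) (K : OpKernel H) : Prop where
  sq : ∀ s u, J s (J s u) = u
  symm : ∀ s u v, inner 𝕜 (J s u) v = inner 𝕜 u (J s v)
  op_comm : ∀ {s t : S} (α : G.Fib s t) (u : D.space s), D.op α (J s u) = J t (D.op α u)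
  factor : ∀ (s : S) (x y : A.Block s) (h : H x.1) (k : H y.1),
    inner 𝕜 h (K x.1 y.1 k) = inner 𝕜 (D.V x h) (J s (D.V y k))

namespace PolarSystem

variable (D : PolarSystem hH K)

/-- The orthogonal complement of the kernel of `Z`. -/
abbrev support (s : S) : Submodule 𝕜 (D.space s) := (D.Z s).kerᗮ

theorem mem_support {s : S} {u : D.space s} :
    u ∈ D.support s ↔ ∀ v, D.Z s v = 0 → inner 𝕜 v u = 0 := by
  simp [support, Submodule.mem_orthogonal]

theorem Z_mem_support {s : S} (u : D.space s) : D.Z s u ∈ D.support s :=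
  D.mem_support.2 fun v hv => by rw [← D.Z_symm, hv, inner_zero_left]

theorem P_mem_support {s : S} {u : D.space s} (hu : u ∈ D.support s) : D.P s u ∈ D.support s :=
  D.mem_support.2 fun v hv => by
    rw [← D.P_symm]
    exact D.mem_support.1 hu _ (by rw [D.Z_P, hv, map_zero])

theorem op_mem_support {s t : S} (α : G.Fib s t) {u : D.space s} (hu : u ∈ D.support s) :
    D.op α u ∈ D.support t :=
  D.mem_support.2 fun v hv => by
    rw [← D.op_star_left]
    exact D.mem_support.1 hu _ (by rw [← D.op_Z, hv, map_zero])

/-- The Hilbert system `x ↦ Z V_x` on the support of `Z`. -/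
noncomputable def supportSystem : HilbertSystem hH where
  space s := ⟨D.support s⟩
  V {s} x := ((D.Z s).comp (D.V x)).codRestrict (D.support s) fun _ => D.Z_mem_support _
  op {s t} α := ((D.op α).comp (D.support s).subtypeL).codRestrict (D.support t)
    fun u => D.op_mem_support α u.2
  op_mul α β u := Subtype.ext (D.op_mul α β u.1)
  op_star α u v := D.op_star α u.1 v.1
  op_V α x h := Subtype.ext (by
    change D.op α (D.Z _ (D.V x h)) = D.Z _ (D.V _ _)
    rw [D.op_Z, D.op_V])

/-- The symmetry `2 P - 1` on the support of `Z`. -/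
noncomputable def supportSymmetry (s : S) :
    D.supportSystem.space s →L[𝕜] D.supportSystem.space s :=
  (((2 : 𝕜) • D.P s - 1).comp (D.support s).subtypeL).codRestrict (D.support s) fun u =>
    Submodule.sub_mem _ (Submodule.smul_mem _ _ (D.P_mem_support u.2)) u.2

theorem supportSymmetry_coe (s : S) (u : D.support s) :
    (D.supportSymmetry s u : D.support s).1 = (2 : 𝕜) • D.P s u.1 - u.1 := rfl

theorem isSymmetryFor_support : D.supportSystem.IsSymmetryFor D.supportSymmetry K where
  sq s u := Subtype.ext (by
    refine (D.supportSymmetry_coe s _).trans ?_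
    rw [D.supportSymmetry_coe s u, map_sub, map_smul, D.P_idem, smul_sub, two_smul, two_smul]
    abel)
  symm s u v := by
    change inner 𝕜 ((2 : 𝕜) • D.P s u.1 - u.1) v.1 = inner 𝕜 u.1 ((2 : 𝕜) • D.P s v.1 - v.1)
    simp only [inner_sub_left, inner_sub_right, inner_smul_left, inner_smul_right, D.P_symm,
      map_ofNat]
  op_comm {s t} α u := Subtype.ext (by
    change D.op α ((2 : 𝕜) • D.P s u.1 - u.1) = (2 : 𝕜) • D.P t (D.op α u.1) - D.op α u.1
    simp [D.op_P])
  factor := D.factor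

/-- Orthogonality to all `Z V_x h` gives `Z u = 0` by minimality, while `u` is orthogonal to `ker
Z`. This totality is the reason for cutting down to the support. -/
theorem eq_zero_of_inner_supportSystem {s : S} (u : D.supportSystem.space s)
    (hu : ∀ x h, inner 𝕜 (D.supportSystem.V x h) u = 0) : u = 0 := by
  have h1 : D.Z s u.1 = 0 := by
    refine eq_of_inner_eq (D.isMinimal s) fun x h => ?_
    rw [← D.Z_symm, inner_zero_right]
    exact hu x h
  have h2 : inner 𝕜 u.1 u.1 = 0 := D.mem_support.1 u.2 _ h1
  exact Subtype.ext (inner_self_eq_zero.1 h2)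

end PolarSystem

/-- Since `D.op α` commutes with the symmetry, its Hilbert adjoint is also its adjoint for the
indefinite form, so the representation transports to a Krein space `*`-representation. -/
theorem HilbertSystem.IsSymmetryFor.exists_rkKreinSpace {D : HilbertSystem hH}
    {J₀ : ∀ s, D.space s →L[𝕜] D.space s} (hJ : D.IsSymmetryFor J₀ K)
    (hD : ∀ (s : S) (u : D.space s), (∀ x h, inner 𝕜 (D.V x h) u = 0) → u = 0) :
    ∃ (R : ∀ s : S, RKKreinSpace (K.block A s))
      (Φ : StarRep G (fun s : S => (R s).toKreinSpace))
      (J : ∀ s : S, (R s).toKreinSpace →ₗ[𝕜] (R s).toKreinSpace),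
      (∀ s : S, IsFundamentalSymmetry (R s).toKreinSpace.form (J s)) ∧
      (∀ (s t : S) (α : G.Fib s t) (f : (R s).toKreinSpace),
        Φ.op α (J s f) = J t (Φ.op α f)) ∧
      (∀ (s t : S) (α : G.Fib s t) (x : A.Block s) (h : H x.1),
        (R t).col (A.smul α x) (HilbertSp.ident (hH α x).symm h) =
          Φ.op α ((R s).col x h)) := by
  choose R e hform hcol using fun s => KreinKernel.exists_rkKreinSpace (K := K.block A s)
    (fun x : A.Block s => D.V x) (J₀ s) (hJ.sq s) (hJ.symm s) (hD s) (hJ.factor s)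
  let J : ∀ s : S, (R s).toKreinSpace →ₗ[𝕜] (R s).toKreinSpace := fun s =>
    (e s).symm.toLinearMap.comp ((J₀ s).toLinearMap.comp (e s).toLinearMap)
  have heJ : ∀ s f, e s (J s f) = J₀ s (e s f) := fun s f => by simp [J]
  have hBJ : ∀ s (f g : (R s).toKreinSpace),
      (R s).toKreinSpace.form (J s f) g = inner 𝕜 (e s g) (e s f) := fun s f g => by
    rw [hform, heJ, hJ.sq]
  have hfund : ∀ s, IsFundamentalSymmetry (R s).toKreinSpace.form (J s) := fun s =>
    isFundamentalSymmetry_of_equiv (fun f => (e s).injective (by rw [heJ, heJ, hJ.sq])) (e s)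
      (hBJ s)
  choose T hT using fun (s t : S) (α : G.Fib s t) =>
    KreinSpace.exists_clm_of_equiv (R s).toKreinSpace (R t).toKreinSpace (hfund s) (hfund t)
      (e s) (e t) (hBJ s) (hBJ t) (D.op α)
  refine ⟨R, ⟨fun {s t} α => T s t α, fun {r s t} α β => ?_, fun {s t} α f g => ?_⟩, J, hfund,
    fun s t α f => (e t).injective ?_, fun s t α x h => (e t).injective ?_⟩
  · refine DFunLike.ext _ _ fun f => (e t).injective ?_
    change e t (T r t (α.mul β) f) = e t (T s t α (T r s β f))
    rw [hT, hT, hT, D.op_mul]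
  · change (R t).toKreinSpace.form (T s t α f) g = (R s).toKreinSpace.form f (T t s α.star g)
    rw [hform, hform, hT, hT, D.op_star_left, hJ.op_comm]
  · rw [hT, heJ, heJ, hT, hJ.op_comm]
  · rw [hT, hcol, hcol, D.op_V]

end Models

/-! ### Domination, decomposition and linearisation. -/

section Implications

variable {𝕜 : Type w} [RCLike 𝕜] {Γ : Type uΓ} {S : Type uS} {G : StarSemigroupoid Γ S}
  {X : Type u} {A : LeftAction G X} {H : X → HilbertSp.{v} 𝕜}

/-- Write `2K = (L + K) - (L - K)` and `2L` as the sum; apply the Schwarz inequality to each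
positive kernel, then once more in the plane. -/
theorem OpKernel.norm_form_le {Y : Type u} {H : Y → HilbertSp.{v} 𝕜} {K L : OpKernel H}
    (h1 : (L + K).IsPosSemidef) (h2 : (L - K).IsPosSemidef) (f g : FinSection H) :
    ‖K.form f g‖ ≤ √(RCLike.re (L.form f f)) * √(RCLike.re (L.form g g)) := by
  obtain ⟨E, V, hV, -⟩ := h1.exists_factor
  obtain ⟨F, W, hW, -⟩ := h2.exists_factor
  have hL : ∀ f, RCLike.re (L.form f f) =
      (‖synthesis V f‖ ^ 2 + ‖synthesis W f‖ ^ 2) / 2 := fun f => by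
    rw [← form_self_eq_norm_sq V hV, ← form_self_eq_norm_sq W hW, form_add, form_sub, map_add,
      map_sub]
    ring
  have hK : (2 : 𝕜) * K.form f g =
      inner 𝕜 (synthesis V g) (synthesis V f) - inner 𝕜 (synthesis W g) (synthesis W f) := by
    have e1 := form_eq_inner V (ContinuousLinearMap.id 𝕜 E) hV f g
    have e2 := form_eq_inner W (ContinuousLinearMap.id 𝕜 F) hW f g
    simp only [ContinuousLinearMap.id_apply] at e1 e2
    rw [← e1, ← e2, form_add, form_sub]
    ring
  have hK' : 2 * ‖K.form f g‖ ≤ ‖synthesis V g‖ * ‖synthesis V f‖ +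
      ‖synthesis W g‖ * ‖synthesis W f‖ := by
    have := congrArg norm hK
    rw [norm_mul, RCLike.norm_ofNat] at this
    rw [this]
    exact (norm_sub_le _ _).trans (add_le_add (norm_inner_le_norm _ _) (norm_inner_le_norm _ _))
  rw [hL, hL, ← Real.sqrt_mul (by positivity)]
  refine Real.le_sqrt_of_sq_le ?_
  set a := ‖synthesis V f‖
  set b := ‖synthesis V g‖
  set c := ‖synthesis W f‖
  set d := ‖synthesis W g‖
  have h3 : (2 * ‖K.form f g‖) ^ 2 ≤ (b * a + d * c) ^ 2 := by gcongr
  nlinarith [sq_nonneg (a * d - b * c)]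

theorem IsBoundedShift.add {hH : ConstantOnOrbits A H} {K L : OpKernel H}
    (hK : IsBoundedShift hH K) (hL : IsBoundedShift hH L) (hK' : IsPartiallyPosSemidef A K)
    (hL' : IsPartiallyPosSemidef A L) : IsBoundedShift hH (K + L) := by
  intro s t α
  obtain ⟨M, hM, h1⟩ := hK α
  obtain ⟨N, hN, h2⟩ := hL α
  -- The cross terms `M [g, g]_L` and `N [g, g]_K` are nonnegative, so the sum of the constants
  -- works.
  refine ⟨M + N, add_nonneg hM hN, fun g => ?_⟩
  have e1 : (K + L).shift hH α = K.shift hH α + L.shift hH α := by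
    funext x y; ext k; simp [OpKernel.shift]
  have e2 : (K + L).block A s = K.block A s + L.block A s := rfl
  rw [e1, e2, OpKernel.form_add, OpKernel.form_add, map_add, map_add]
  nlinarith [h1 g, h2 g, (hK' s).nonneg g, (hL' s).nonneg g,
    mul_nonneg hM ((hL' s).nonneg g), mul_nonneg hN ((hK' s).nonneg g)]

theorem exists_dominating_of_decomposition {hH : ConstantOnOrbits A H} {K K₁ K₂ : OpKernel H}
    (hK : K = K₁ - K₂)
    (h1 : IsPartiallyPosSemidef A K₁ ∧ IsGammaInvariant hH K₁ ∧ IsBoundedShift hH K₁)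
    (h2 : IsPartiallyPosSemidef A K₂ ∧ IsGammaInvariant hH K₂ ∧ IsBoundedShift hH K₂) :
    IsGammaInvariant hH K ∧ ∃ L : OpKernel H, IsPartiallyPosSemidef A L ∧ IsGammaInvariant hH L ∧
      IsBoundedShift hH L ∧ PartialLE A (-L) K ∧ PartialLE A K L := by
  subst hK
  -- With `L = K₁ + K₂`, `K + L = 2 K₁` and `L - K = 2 K₂`.
  refine ⟨IsGammaInvariant.sub (hH := hH) h1.2.1 h2.2.1, K₁ + K₂,
    fun s => (h1.1 s).add (h2.1 s), IsGammaInvariant.add (hH := hH) h1.2.1 h2.2.1,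
    IsBoundedShift.add (hH := hH) h1.2.2 h2.2.2 h1.1 h2.1, ?_, ?_⟩
  · have e : K₁ - K₂ - -(K₁ + K₂) = K₁ + K₁ := by abel
    intro s
    rw [e]; exact (h1.1 s).add (h1.1 s)
  · have e : K₁ + K₂ - (K₁ - K₂) = K₂ + K₂ := by abel
    intro s
    rw [e]; exact (h2.1 s).add (h2.1 s)

/-- `(1 + J) / 2` and `(1 - J) / 2` are orthogonal projections commuting with the representation,
and their difference is `J`. -/
theorem HilbertSystem.IsSymmetryFor.exists_decomposition {hH : ConstantOnOrbits A H}
    {K : OpKernel H} {D : HilbertSystem hH} {J : ∀ s, D.space s →L[𝕜] D.space s}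
    (hJ : D.IsSymmetryFor J K) : ∃ K₁ K₂ : OpKernel H, K = K₁ - K₂ ∧
      (IsPartiallyPosSemidef A K₁ ∧ IsGammaInvariant hH K₁ ∧ IsBoundedShift hH K₁) ∧
      (IsPartiallyPosSemidef A K₂ ∧ IsGammaInvariant hH K₂ ∧ IsBoundedShift hH K₂) := by
  have hr : conj (2⁻¹ : 𝕜) = 2⁻¹ := by simp [map_ofNat (starRingEnd 𝕜) 2]
  have hJ2 : ∀ s u v, inner 𝕜 (J s u) (J s v) = inner 𝕜 u v := fun s u v => by
    rw [hJ.symm, hJ.sq]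
  let D₁ := D.compress (fun s => (2⁻¹ : 𝕜) • (1 + J s)) fun α u => by simp [hJ.op_comm]
  let D₂ := D.compress (fun s => (2⁻¹ : 𝕜) • (1 - J s)) fun α u => by simp [hJ.op_comm]
  have h1 : D₁.Factors D₁.kernel := D₁.factors_kernel
  have h2 : D₂.Factors (D₁.kernel - K) := by
    intro s x y h k
    have e1 : inner 𝕜 h (D₁.kernel x.1 y.1 k) =
        inner 𝕜 ((2⁻¹ : 𝕜) • (D.V x h + J s (D.V x h))) ((2⁻¹ : 𝕜) • (D.V y k + J s (D.V y k))) :=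
      h1 s x y h k
    change inner 𝕜 h (D₁.kernel x.1 y.1 k - K x.1 y.1 k) =
      inner 𝕜 ((2⁻¹ : 𝕜) • (D.V x h - J s (D.V x h))) ((2⁻¹ : 𝕜) • (D.V y k - J s (D.V y k)))
    rw [inner_sub_right, e1, hJ.factor]
    simp only [inner_smul_left, inner_smul_right, inner_add_left, inner_add_right, inner_sub_left,
      inner_sub_right, hr, hJ2]
    simp only [hJ.symm]
    ring
  exact ⟨_, _, (sub_sub_cancel _ _).symm,
    ⟨h1.isPartiallyPosSemidef, h1.isGammaInvariant, h1.isBoundedShift⟩,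
    ⟨h2.isPartiallyPosSemidef, h2.isGammaInvariant, h2.isBoundedShift⟩⟩

/-- For the inner product `[J ·, ·]`, the Hilbert adjoint of an operator that commutes with the
symmetries is its Krein adjoint, so `Ψ` becomes a Hilbert space `*`-representation. -/
theorem PartialLinearisation.exists_isSymmetryFor (hH : ConstantOnOrbits A H) {K : OpKernel H}
    (L : PartialLinearisation A K) (Ψ : StarRep G L.space)
    {J : ∀ s : S, L.space s →ₗ[𝕜] L.space s}
    (hΨV : ∀ (s t : S) (α : G.Fib s t) (x : A.Block s) (h : H x.1),
      Ψ.op α (L.V x h) = L.V (A.smul α x) (HilbertSp.ident (hH α x).symm h))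
    (hJ : ∀ s : S, IsFundamentalSymmetry (L.space s).form (J s))
    (hΨJ : ∀ (s t : S) (α : G.Fib s t) (f : L.space s), Ψ.op α (J s f) = J t (Ψ.op α f)) :
    ∃ (D : HilbertSystem hH) (J₀ : ∀ s, D.space s →L[𝕜] D.space s), D.IsSymmetryFor J₀ K := by
  choose e he using fun s => (L.space s).exists_equiv (hJ s)
  have hJe : ∀ s (u v : L.space s), inner 𝕜 (e s (J s u)) (e s v) =
      inner 𝕜 (e s u) (e s (J s v)) := fun s u v => by
    have := (hJ s).hilbert.posDef.conj_symm v (J s u)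
    simp only [LinearMap.comp_apply, (hJ s).sq] at this
    rw [← he, ← he, (hJ s).sq, ← this, (L.space s).isKrein.conj_symm]
  let D : HilbertSystem hH :=
    { space := fun s => (L.space s).toHilbertSp (hJ s)
      V := fun {s} x => (e s).toContinuousLinearMap.comp (L.V x)
      op := fun {s t} α => (e t).toContinuousLinearMap.comp
        ((Ψ.op α).comp (e s).symm.toContinuousLinearMap)
      op_mul := fun α β u => by simp [Ψ.map_mul]
      op_star := fun {s t} α u v => by
        obtain ⟨u, rfl⟩ := (e s).surjective u
        obtain ⟨v, rfl⟩ := (e t).surjective v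
        have h1 := Ψ.map_star α.star (J t v) u
        rw [StarSemigroupoid.Fib.star_star] at h1
        simp only [ContinuousLinearMap.comp_apply, ContinuousLinearEquiv.coe_coe,
          ContinuousLinearEquiv.symm_apply_apply]
        rw [← he, ← he, ← h1, hΨJ]
      op_V := fun α x h => by simp [hΨV] }
  have hsymm : ∀ s, (((e s).toLinearEquiv.conj (J s))).IsSymmetric := fun s u v => by
    obtain ⟨u, rfl⟩ := (e s).surjective u
    obtain ⟨v, rfl⟩ := (e s).surjective v
    simpa [LinearEquiv.conj_apply] using hJe s u v
  -- Boundedness of the symmetry is the Hellinger–Toeplitz theorem.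
  let J₀ : ∀ s, D.space s →L[𝕜] D.space s := fun s => ⟨_, (hsymm s).continuous⟩
  have hJ₀ : ∀ s (u : L.space s), J₀ s (e s u) = e s (J s u) := fun s u => by
    change (e s).toLinearEquiv.conj (J s) (e s u) = _
    simp [LinearEquiv.conj_apply]
  refine ⟨D, J₀, ⟨fun s u => ?_, hsymm, fun {s t} α u => ?_, fun s x y h k => ?_⟩⟩
  · obtain ⟨u, rfl⟩ := (e s).surjective u
    rw [hJ₀, hJ₀, (hJ s).sq]
  · obtain ⟨u, rfl⟩ := (e s).surjective u
    rw [hJ₀]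
    simp only [D, ContinuousLinearMap.comp_apply, ContinuousLinearEquiv.coe_coe,
      ContinuousLinearEquiv.symm_apply_apply, hΨJ]
    exact (hJ₀ _ _).symm
  · change _ = inner 𝕜 (e s (L.V x h)) (J₀ s (e s (L.V y k)))
    rw [hJ₀, ← he, (hJ s).sq, L.factor]

/-- A submodule of a Krein space with trivial orthogonal companion is dense. -/
theorem KreinSpace.dense_of_form_eq_zero (K : KreinSpace.{v} 𝕜) (M : Submodule 𝕜 K)
    (hM : ∀ w, (∀ v ∈ M, K.form w v = 0) → w = 0) : Dense (M : Set K) := by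
  obtain ⟨J, hJ⟩ := K.isKrein.exists_symmetry
  obtain ⟨e, he⟩ := K.exists_equiv hJ
  have h1 : (M.map e.toLinearEquiv.toLinearMap).topologicalClosure = ⊤ := by
    rw [Submodule.topologicalClosure_eq_top_iff, Submodule.eq_bot_iff]
    intro z hz
    obtain ⟨z, rfl⟩ := e.surjective z
    have h2 : J z = 0 := hM _ fun v hv => by
      rw [he]
      exact (Submodule.mem_orthogonal _ _).1 hz _ ⟨v, hv, rfl⟩
    rw [← hJ.sq z, h2, map_zero, map_zero]
  rw [← Submodule.dense_iff_topologicalClosure_eq_top] at h1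
  have h3 := e.symm.surjective.denseRange.dense_image e.symm.continuous h1
  convert h3
  ext v
  simp

/-- The map `h ↦ K_x h`. -/
def RKKreinSpace.colₗ {Y : Type u} {H : Y → HilbertSp.{v} 𝕜} {K : OpKernel H}
    (R : RKKreinSpace K) (x : Y) : H x →ₗ[𝕜] R.toKreinSpace where
  toFun := R.col x
  map_add' _ _ := Subtype.ext (funext fun _ => map_add _ _ _)
  map_smul' _ _ := Subtype.ext (funext fun _ => map_smul _ _ _)

theorem RKKreinSpace.form_col {Y : Type u} {H : Y → HilbertSp.{v} 𝕜} {K : OpKernel H}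
    (R : RKKreinSpace K) (f : R.toKreinSpace) (x : Y) (h : H x) :
    R.toKreinSpace.form f (R.col x h) = inner 𝕜 h ((f : R.space).1 x) :=
  (R.reproducing f x h).symm

/-- The reproducing property makes `h ↦ K_x h` weakly continuous, which suffices for boundedness. -/
theorem RKKreinSpace.continuous_form_colₗ {Y : Type u} {H : Y → HilbertSp.{v} 𝕜}
    {K : OpKernel H} (R : RKKreinSpace K) (x : Y) (f : R.toKreinSpace) :
    Continuous fun h => R.toKreinSpace.form f (R.colₗ x h) := by
  change Continuous fun h => R.toKreinSpace.form f (R.col x h)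
  simp only [R.form_col]
  fun_prop

/-- The linearisation `V_x h = K_x h` given by reproducing kernel Krein spaces. -/
noncomputable def PartialLinearisation.ofRKKreinSpace {K : OpKernel H}
    (R : ∀ s : S, RKKreinSpace (K.block A s)) : PartialLinearisation A K where
  space s := (R s).toKreinSpace
  V {s} x :=
    (R s).toKreinSpace.clmOfWeak ((R s).colₗ x) ((R s).continuous_form_colₗ x)
  factor {s} x y h k := ((R s).form_col ((R s).col y k) x h).symm

/-- By the reproducing property, an element orthogonal to all columns vanishes pointwise. -/
theorem PartialLinearisation.isMinimal_ofRKKreinSpace {K : OpKernel H}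
    (R : ∀ s : S, RKKreinSpace (K.block A s)) : (ofRKKreinSpace R).IsMinimal := by
  intro s
  refine KreinSpace.dense_of_form_eq_zero _ _ fun w hw => Subtype.ext (funext fun x => ?_)
  refine ext_inner_left 𝕜 fun h => ?_
  rw [← (R s).form_col w x h]
  refine (hw _ (Submodule.subset_span ⟨x, h, rfl⟩)).trans ?_
  exact (inner_zero_right _).symm

end Implications

end KreinKernel

theorem theoremt {𝕜 : Type w} [RCLike 𝕜] {Γ : Type uΓ} {S : Type uS}
    (G : StarSemigroupoid Γ S) {X : Type u} (A : LeftAction G X)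
    (H : X → HilbertSp.{v} 𝕜) (hH : ConstantOnOrbits A H)
    (K : OpKernel H) (hK : IsPartiallyHermitian A K) :
    List.TFAE [
      -- (1)
      IsGammaInvariant hH K ∧ ∃ L : OpKernel H, IsPartiallyPosSemidef A L ∧ IsGammaInvariant hH L ∧
        IsBoundedShift hH L ∧ PartialLE A (-L) K ∧ PartialLE A K L,
      -- (2)
      IsGammaInvariant hH K ∧ ∃ L : OpKernel H, IsPartiallyPosSemidef A L ∧ IsGammaInvariant hH L ∧
        IsBoundedShift hH L ∧
        ∀ (s : S) (f g : FinSection (fun x : A.Block s => H x.1)),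
          ‖(K.block A s).form f g‖ ≤
            √(RCLike.re ((L.block A s).form f f)) * √(RCLike.re ((L.block A s).form g g)),
      -- (3)
      ∃ K₁ K₂ : OpKernel H, K = K₁ - K₂ ∧
        (IsPartiallyPosSemidef A K₁ ∧ IsGammaInvariant hH K₁ ∧ IsBoundedShift hH K₁) ∧
        (IsPartiallyPosSemidef A K₂ ∧ IsGammaInvariant hH K₂ ∧ IsBoundedShift hH K₂),
      -- (3)'
      ∃ K₁ K₂ : OpKernel H, K = K₁ - K₂ ∧
        (IsPartiallyPosSemidef A K₁ ∧ IsGammaInvariant hH K₁ ∧ IsBoundedShift hH K₁) ∧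
        (IsPartiallyPosSemidef A K₂ ∧ IsGammaInvariant hH K₂ ∧ IsBoundedShift hH K₂) ∧
        AreDisjoint A K₁ K₂,
      -- (4)
      ∃ (L : PartialLinearisation A K) (Ψ : StarRep G L.space)
        (J : ∀ s : S, L.space s →ₗ[𝕜] L.space s),
        L.IsMinimal ∧
        (∀ (s t : S) (α : G.Fib s t) (x : A.Block s) (h : H x.1),
          Ψ.op α (L.V x h) = L.V (A.smul α x) (HilbertSp.ident (hH α x).symm h)) ∧
        (∀ s : S, IsFundamentalSymmetry (L.space s).form (J s)) ∧
        (∀ (s t : S) (α : G.Fib s t) (f : L.space s), Ψ.op α (J s f) = J t (Ψ.op α f)),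
      -- (5)
      ∃ (R : ∀ s : S, RKKreinSpace (K.block A s))
        (Φ : StarRep G (fun s : S => (R s).toKreinSpace))
        (J : ∀ s : S, (R s).toKreinSpace →ₗ[𝕜] (R s).toKreinSpace),
        (∀ s : S, IsFundamentalSymmetry (R s).toKreinSpace.form (J s)) ∧
        (∀ (s t : S) (α : G.Fib s t) (f : (R s).toKreinSpace),
          Φ.op α (J s f) = J t (Φ.op α f)) ∧
        (∀ (s t : S) (α : G.Fib s t) (x : A.Block s) (h : H x.1),
          (R t).col (A.smul α x) (HilbertSp.ident (hH α x).symm h) =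
            Φ.op α ((R s).col x h))
    ] := by
  -- Numbers are positions in the list: 4 is the disjoint decomposition, 5 the minimal
  -- linearisation, 6 the reproducing kernel spaces.
  tfae_have 1 → 2 := fun ⟨hinv, L, hL, hLinv, hLsh, h1, h2⟩ =>
    ⟨hinv, L, hL, hLinv, hLsh, fun s => OpKernel.norm_form_le
      (by have := h1 s; rwa [sub_neg_eq_add, add_comm] at this) (h2 s)⟩
  tfae_have 2 → 4 := fun ⟨hinv, L, hL, hLinv, hLsh, h⟩ =>
    have ⟨D⟩ := exists_polarSystem (hH := hH) hK hinv hL hLinv hLsh h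
    D.exists_disjoint_decomposition
  tfae_have 4 → 3 := fun ⟨K₁, K₂, hK', h1, h2, _⟩ => ⟨K₁, K₂, hK', h1, h2⟩
  tfae_have 3 → 1 := fun ⟨K₁, K₂, hK', h1, h2⟩ => exists_dominating_of_decomposition hK' h1 h2
  tfae_have 2 → 6 := fun ⟨hinv, L, hL, hLinv, hLsh, h⟩ =>
    have ⟨D⟩ := exists_polarSystem (hH := hH) hK hinv hL hLinv hLsh h
    D.isSymmetryFor_support.exists_rkKreinSpace fun _ => D.eq_zero_of_inner_supportSystem
  tfae_have 6 → 5 := fun ⟨R, Φ, J, hJ, hΦJ, hcol⟩ =>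
    ⟨PartialLinearisation.ofRKKreinSpace R, Φ, J,
      PartialLinearisation.isMinimal_ofRKKreinSpace R,
      fun s t α x h => (hcol s t α x h).symm, hJ, hΦJ⟩
  tfae_have 5 → 3 := fun ⟨L, Ψ, J, _, hV, hJ, hΨJ⟩ =>
    have ⟨_, _, h⟩ := L.exists_isSymmetryFor hH Ψ hV hJ hΨJ
    h.exists_decomposition
  tfae_finish
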